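/- **Theorem 1.4.** Let $c:\mathbf R\to\mathbf R$ satisfy (A-1) $c(x)>0$ for all $x\in\mathbf R$, $c,\,c^{-1}\in L^\infty(\mathbf R)$, and the weak derivative $c'$ exists and belongs to $L^\infty(\mathbf R)$; (A-2) there is a constant $L>0$ such that $c(x)=1$ for $|x|>L$; and assume that $\eta:=2L\,\|1/c\|_{\infty}\,\|c'\|_{\infty}\in[0,1)$. Let $(u_0,u_1)\in H^1(\mathbf R)\times L^2(\mathbf R)$ be real-valued with $$\int_{\mathbf R}(1+|x|)\Big(\frac{1}{c(x)^2}|u_1(x)|^2+|u_0'(x)|^2\Big)\,dx<+\infty .$$ Let $u\in C([0,\infty);H^1(\mathbf R))\cap C^1([0,\infty);L^2(\mathbf R))$ be the (unique) weak solution of $$u_{tt}-c(x)^2u_{xx}=0,\qquad u(0,\cdot)=u_0,\quad u_t(0,\cdot)=u_1,$$ that is, $u(0)=u_0$, $u_t(0)=u_1$ and, for all $v\in C_c^\infty(\mathbf R)$ and $t\ge 0$, $$\frac{d}{dt}\int_{\mathbf R}\frac{1}{c(x)^2}\,u_t(t,x)\,v(x)\,dx=-\int_{\mathbf R}u_x(t,x)\,v'(x)\,dx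 .$$ Then for each $R>L$ the local energy $$E_R(t):=\frac12\int_{|x|\le R}\Big(\frac{1}{c(x)^2}|u_t(t,x)|^2+|u_x(t,x)|^2\Big)\,dx$$ satisfies $$E_R(t)=O\big(t^{-(1-\eta)}\big)\qquad(t\to\infty).$$ -/

import Mathlib

open MeasureTheory Set Filter Asymptotics Topology
open scoped ContDiff

noncomputable section

namespace LocalEnergyDecay

/-- The space `L²(ℝ)` of real-valued functions, with Lebesgue measure. -/
abbrev L2 : Type := Lp ℝ 2 (volume : Measure ℝ)

/-- `g` is the weak (distributional) derivative of `f` on `ℝ`: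
`∫ f φ' = - ∫ g φ` for all test functions `φ ∈ C_c^∞(ℝ)`. -/
structure HasWeakDeriv (f g : ℝ → ℝ) : Prop where
  locInt : LocallyIntegrable f volume
  locInt_deriv : LocallyIntegrable g volume
  integral_eq : ∀ φ : ℝ → ℝ, ContDiff ℝ ∞ φ → HasCompactSupport φ →
    ∫ x, f x * deriv φ x = - ∫ x, g x * φ x

/-- The essential supremum norm `‖f‖_∞` (used below only for `f ∈ L^∞`). -/
def linftyNorm (f : ℝ → ℝ) : ℝ := (eLpNorm f ⊤ (volume : Measure ℝ)).toReal

/-- Assumption (A-1) on the wave speed `c`, whose weak derivative is `dc`: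
`c > 0` and `c, c⁻¹, dc ∈ L^∞(ℝ)`. -/
structure AssumptionA1 (c dc : ℝ → ℝ) : Prop where
  pos : ∀ x, 0 < c x
  memLp : MemLp c ⊤ (volume : Measure ℝ)
  memLp_inv : MemLp (fun x => (c x)⁻¹) ⊤ (volume : Measure ℝ)
  weakDeriv : HasWeakDeriv c dc
  memLp_deriv : MemLp dc ⊤ (volume : Measure ℝ)

/-- Assumption (A-2) on the wave speed `c`, with the constant `L > 0`. -/
structure AssumptionA2 (c : ℝ → ℝ) (L : ℝ) : Prop where
  pos : 0 < L
  eq_one : ∀ x, L < |x| → c x = 1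

/-- `η = 2 L ‖1/c‖_∞ ‖c'‖_∞`. -/
def eta (c dc : ℝ → ℝ) (L : ℝ) : ℝ :=
  2 * L * linftyNorm (fun x => (c x)⁻¹) * linftyNorm dc

/-- `u ∈ C([0,∞); H¹(ℝ)) ∩ C¹([0,∞); L²(ℝ))`, with spatial weak derivative `ux` and time
derivative `ut` (both are determined by `u` for `t ≥ 0`). Only the values at `t ≥ 0` matter; the
derivative at `t = 0` is one-sided. As `‖f‖_{H¹}² = ‖f‖² + ‖f'‖²`, continuity into `H¹` is
continuity of both `u` and `ux` into `L²`. -/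
structure IsC1Class (u ux ut : ℝ → L2) : Prop where
  weakDeriv : ∀ t, 0 ≤ t → HasWeakDeriv (u t) (ux t)
  continuousOn : ContinuousOn u (Ici 0)
  continuousOn_ux : ContinuousOn ux (Ici 0)
  hasDeriv : ∀ t, 0 ≤ t → HasDerivWithinAt u (ut t) (Ici 0) t
  continuousOn_ut : ContinuousOn ut (Ici 0)

/-- `u`, with derivatives `ux` and `ut`, is a weak solution in
`C([0,∞); H¹(ℝ)) ∩ C¹([0,∞); L²(ℝ))` of `u_tt - c² u_xx = 0`, `u(0) = u₀`, `u_t(0) = u₁`.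
The equation is read as `c⁻² u_tt = u_xx` and tested against functions `v ∈ C_c^∞(ℝ)`:
`d/dt (c⁻² u_t(t), v) = - (u_x(t), v')` for all `t ≥ 0`. -/
structure IsWeakSolution (c : ℝ → ℝ) (u₀ u₁ : L2) (u ux ut : ℝ → L2) : Prop where
  regularity : IsC1Class u ux ut
  initial : u 0 = u₀
  initial_deriv : ut 0 = u₁
  equation : ∀ v : ℝ → ℝ, ContDiff ℝ ∞ v → HasCompactSupport v → ∀ t, 0 ≤ t →
    HasDerivWithinAt (fun s => ∫ x, 1 / c x ^ 2 * ut s x * v x)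
      (- ∫ x, ux t x * deriv v x) (Ici 0) t

/-- The local energy `E_R(t) = ½ ∫_{|x| ≤ R} (c⁻² |u_t(t,x)|² + |u_x(t,x)|²) dx`. -/
def localEnergy (c : ℝ → ℝ) (ux ut : ℝ → L2) (R t : ℝ) : ℝ :=
  1 / 2 * ∫ x in {x : ℝ | |x| ≤ R}, (1 / c x ^ 2 * |ut t x| ^ 2 + |ux t x| ^ 2)

end LocalEnergyDecay

end

/-!
# Local energy decay for the one-dimensional wave equation with variable speed

Write the equation as `κ u_tt = u_xx` with `κ = c⁻²`, and put `P = u_t`, `Q = u_x`. The energy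
density `e = ½ (κ P² + Q²)` and the momentum density `κ P Q` satisfy the conservation laws
`e_t = (P Q)_x` and `(κ P Q)_t = e_x - ½ κ' P²`. Testing the second one with the
multiplier `x` gives the virial identity
`d/dt [t E + ∫ x κ P Q] = - ½ ∫ x κ' P² ≤ η E_R`,
where `E` is the conserved total energy: since `κ' = 0` outside `[-L, L]`, the right side only sees
the local energy, and `L |κ'| ≤ 2 L ‖c'‖ ‖1/c‖ κ = η κ`.

On the other hand `t E + ∫ x κ P Q` is at least `(t - K R) E_R - C`. Inside `[-R, R]` this is
`√κ ≤ K = ‖1/c‖`; outside, where `κ = 1`, the density is at least `(t - |x|) e`, whose negative part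
is integrable uniformly in time by finite speed of propagation: the energy with the outgoing weight
`φ(|x| - t)` does not increase (`ConservationLaws.weightedEnergy_radialShift_le`), and it is
finite at `t = 0` by the weighted assumption on the data. Hence
`(t - K R) E_R(t) ≤ C + η ∫₀ᵗ E_R` (`ConservationLaws.exists_localEnergy_le`), and Grönwall's
argument gives `E_R = O(t ^ (η - 1))` (`isBigO_rpow_of_sub_mul_le`).

Two points make this rigorous for weak solutions. The conservation laws are proved for the Steklov
averages in time, which are strong solutions because the equation is autonomous, and pass to the
limit in integrated form (`IsWeakSolution.conservationLaws`). And they are only used with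
time-independent bounded Lipschitz weights: the multiplier `x` is truncated at `|x| = 2 t + R + 1`,
where the tail energy is `O(1 / t)`, and the moving weight is compared with frozen ones.
-/

noncomputable section

namespace LocalEnergyDecay

/-! ### Weak derivatives and absolutely continuous representatives -/

lemma exists_support_subset_Ioo {φ : ℝ → ℝ} (hφ : HasCompactSupport φ) :
    ∃ M : ℝ, 0 < M ∧ Function.support φ ⊆ Ioo (-M) M := by
  obtain ⟨r, hr⟩ := hφ.isCompact.isBounded.subset_closedBall (0 : ℝ)
  refine ⟨|r| + 1, by positivity, fun x hx => ?_⟩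
  have h := hr (subset_tsupport φ hx)
  rw [Real.closedBall_eq_Icc] at h
  have := le_abs_self r
  constructor <;> linarith [h.1, h.2]

lemma support_deriv_subset_Ioc {φ : ℝ → ℝ} {M : ℝ} (h : Function.support φ ⊆ Ioo (-M) M) :
    Function.support (deriv φ) ⊆ Ioc (-M - 1) (M + 1) := by
  intro x hx
  have h1 : tsupport φ ⊆ Icc (-M) M :=
    closure_minimal (h.trans Ioo_subset_Icc_self) isClosed_Icc
  have := h1 (support_deriv_subset hx)
  constructor <;> linarith [this.1, this.2]

lemma integral_primitive_mul_deriv {g φ : ℝ → ℝ} (hg : LocallyIntegrable g volume)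
    (hφ : ContDiff ℝ ∞ φ) (hc : HasCompactSupport φ) :
    ∫ x, (∫ t in (0 : ℝ)..x, g t) * deriv φ x = - ∫ x, g x * φ x := by
  obtain ⟨M, hM, hsupp⟩ := exists_support_subset_Ioo hc
  have hsupp' := support_deriv_subset_Ioc hsupp
  have hgi : ∀ a b, IntervalIntegrable g volume a b := fun a b =>
    (hg.integrableOn_isCompact isCompact_uIcc).intervalIntegrable
  have h1 : ∫ x, (∫ t in (0 : ℝ)..x, g t) * deriv φ x =
      ∫ x in (-M - 1)..(M + 1), (∫ t in (0 : ℝ)..x, g t) * deriv φ x :=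
    (intervalIntegral.integral_eq_integral_of_support_subset
      ((Function.support_mul_subset_right _ _).trans hsupp')).symm
  have h2 : ∫ x, g x * φ x = ∫ x in (-M - 1)..(M + 1), g x * φ x :=
    (intervalIntegral.integral_eq_integral_of_support_subset
      ((Function.support_mul_subset_right _ _).trans (hsupp.trans
        (Ioo_subset_Ioc_self.trans (Ioc_subset_Ioc (by linarith) (by linarith)))))).symm
  have hz : ∀ x, x ∉ Ioo (-M) M → φ x = 0 := fun x hx => by
    by_contra h; exact hx (hsupp h)
  rw [h1, h2, AbsolutelyContinuousOnInterval.integral_mul_deriv_eq_deriv_mul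
    (f := fun x => ∫ t in (0 : ℝ)..x, g t)
    ((hgi _ _).absolutelyContinuousOnInterval_intervalIntegral
      (by rw [uIcc_of_le (by linarith)]; constructor <;> linarith))
    ((hφ.of_le (by exact_mod_cast le_top)).contDiffOn.absolutelyContinuousOnInterval),
    hz (M + 1) (by simp), hz (-M - 1) (by simp)]
  simp only [mul_zero, sub_zero, zero_sub]
  congr 1
  apply intervalIntegral.integral_congr_ae
  filter_upwards [LocallyIntegrable.ae_hasDerivAt_integral hg] with x hx _
  rw [(hx 0).deriv]

/-- The lemma of du Bois-Reymond. -/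
lemma exists_ae_eq_const_of_integral_mul_deriv_eq_zero {f : ℝ → ℝ}
    (hf : LocallyIntegrable f volume)
    (h : ∀ φ : ℝ → ℝ, ContDiff ℝ ∞ φ → HasCompactSupport φ → ∫ x, f x * deriv φ x = 0) :
    ∃ C : ℝ, ∀ᵐ x, f x = C := by
  let B : ContDiffBump (0 : ℝ) := default
  let ρ : ℝ → ℝ := B.normed volume
  have hρ : ContDiff ℝ ∞ ρ := B.contDiff_normed
  have hρc : HasCompactSupport ρ := B.hasCompactSupport_normed
  have hρ1 : ∫ x, ρ x = 1 := B.integral_normed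
  have hint : ∀ {ψ : ℝ → ℝ}, ContDiff ℝ ∞ ψ → HasCompactSupport ψ →
      Integrable (fun x => ψ x * f x) := fun hψ hψc => by
    simpa using hf.integrable_smul_left_of_hasCompactSupport hψ.continuous hψc
  refine ⟨∫ x, ρ x * f x, ?_⟩
  have key := ae_eq_zero_of_integral_contDiff_smul_eq_zero (μ := (volume : Measure ℝ))
    (f := fun x => f x - ∫ x, ρ x * f x) (hf.sub (locallyIntegrable_const _)) ?_
  · filter_upwards [key] with x hx
    linarith
  intro ψ hψ hψc
  set I := ∫ x, ψ x with hI
  -- `ψ - (∫ ψ) ρ` has integral zero, hence it is the derivative of a test function.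
  set ζ : ℝ → ℝ := fun x => ψ x - I * ρ x with hζ
  have hζs : ContDiff ℝ ∞ ζ := hψ.sub (contDiff_const.mul hρ)
  have hζc : HasCompactSupport ζ := hψc.sub hρc.mul_left
  have hζ0 : ∫ x, ζ x = 0 := by
    rw [hζ, integral_sub (hψ.continuous.integrable_of_hasCompactSupport hψc)
      ((hρ.continuous.integrable_of_hasCompactSupport hρc).const_mul _), integral_const_mul, hρ1]
    simp [hI]
  obtain ⟨M, hM, hsupp⟩ := exists_support_subset_Ioo hζc
  set φ : ℝ → ℝ := fun x => ∫ t in (-M)..x, ζ t with hφ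
  have hderiv : ∀ x, HasDerivAt φ (ζ x) x := fun x =>
    intervalIntegral.integral_hasDerivAt_right (hζs.continuous.intervalIntegrable _ _)
      (hζs.continuous.stronglyMeasurableAtFilter _ _) hζs.continuous.continuousAt
  have hderiv' : deriv φ = ζ := funext fun x => (hderiv x).deriv
  have hφs : ContDiff ℝ ∞ φ := by
    rw [contDiff_infty_iff_deriv, hderiv']
    exact ⟨fun x => (hderiv x).differentiableAt, hζs⟩
  have hφc : HasCompactSupport φ := by
    refine HasCompactSupport.of_support_subset_isCompact (isCompact_Icc (a := -M) (b := M)) ?_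
    intro x hx
    by_contra hxM
    apply hx
    rcases le_or_gt x (-M) with h1 | h1
    · have : ∀ t ∈ uIcc (-M) x, ζ t = 0 := fun t ht => by
        rw [uIcc_of_ge h1] at ht
        by_contra h0
        exact absurd (hsupp h0).1 (by linarith [ht.2])
      simp only [hφ]
      rw [intervalIntegral.integral_congr (g := fun _ => (0 : ℝ)) this]
      simp
    · have h2 : M < x := by
        by_contra h3
        exact hxM ⟨h1.le, not_lt.1 h3⟩
      simp only [hφ]
      rw [intervalIntegral.integral_eq_integral_of_support_subset, hζ0]
      exact hsupp.trans fun t ht => ⟨ht.1, by linarith [ht.2]⟩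
  have h0 := h φ hφs hφc
  rw [hderiv'] at h0
  have e1 : ∫ x, ψ x • (f x - ∫ x, ρ x * f x) = (∫ x, ψ x * f x) - I * ∫ x, ρ x * f x := by
    simp only [smul_eq_mul, mul_sub]
    rw [integral_sub (hint hψ hψc)
      ((hψ.continuous.integrable_of_hasCompactSupport hψc).mul_const _), integral_mul_const]
  have e2 : ∫ x, f x * ζ x = (∫ x, ψ x * f x) - I * ∫ x, ρ x * f x := by
    rw [← integral_const_mul, ← integral_sub (hint hψ hψc) ((hint hρ hρc).const_mul _)]
    refine integral_congr_ae (Eventually.of_forall fun x => ?_)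
    simp only [hζ]
    ring
  rw [e1, ← e2, h0]

lemma HasWeakDeriv.exists_primitive {f g : ℝ → ℝ} (h : HasWeakDeriv f g) :
    ∃ C : ℝ, ∀ᵐ x, f x = C + ∫ t in (0 : ℝ)..x, g t := by
  have hgi : ∀ a b, IntervalIntegrable g volume a b := fun a b =>
    (h.locInt_deriv.integrableOn_isCompact isCompact_uIcc).intervalIntegrable
  have hcont : Continuous fun x => ∫ t in (0 : ℝ)..x, g t :=
    intervalIntegral.continuous_primitive hgi 0
  have key : ∀ φ : ℝ → ℝ, ContDiff ℝ ∞ φ → HasCompactSupport φ →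
      ∫ x, (f x - ∫ t in (0 : ℝ)..x, g t) * deriv φ x = 0 := by
    intro φ hφ hc
    have hd : Continuous (deriv φ) := hφ.continuous_deriv (by simp)
    have i1 : Integrable fun x => f x * deriv φ x := by
      have := h.locInt.integrable_smul_left_of_hasCompactSupport hd hc.deriv
      simpa [mul_comm] using this
    have i2 : Integrable fun x => (∫ t in (0 : ℝ)..x, g t) * deriv φ x := by
      have := hcont.locallyIntegrable (μ := volume)|>.integrable_smul_left_of_hasCompactSupport
        hd hc.deriv
      simpa [mul_comm] using this
    simp only [sub_mul]
    rw [integral_sub i1 i2, h.integral_eq φ hφ hc, integral_primitive_mul_deriv h.locInt_deriv hφ hc, sub_self]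
  obtain ⟨C, hC⟩ := exists_ae_eq_const_of_integral_mul_deriv_eq_zero
    (h.locInt.sub hcont.locallyIntegrable) key
  exact ⟨C, by filter_upwards [hC] with x hx; rw [Pi.sub_apply] at hx; linarith⟩

lemma absolutelyContinuousOnInterval_primitive {g : ℝ → ℝ} (hg : LocallyIntegrable g volume)
    (C M : ℝ) (hM : 0 ≤ M) :
    AbsolutelyContinuousOnInterval (fun x => C + ∫ t in (0 : ℝ)..x, g t) (-M) M := by
  have h1 : AbsolutelyContinuousOnInterval (fun _ : ℝ => C) (-M) M :=
    (LipschitzWith.const (α := ℝ) C).lipschitzOnWith.absolutelyContinuousOnInterval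
  refine h1.add (IntervalIntegrable.absolutelyContinuousOnInterval_intervalIntegral
    (hg.integrableOn_isCompact isCompact_uIcc).intervalIntegrable ?_)
  rw [uIcc_of_le (by linarith)]
  constructor <;> linarith

/-- A function that is absolutely continuous on bounded intervals and integrable together with
its derivative has `∫ F' = 0`. -/
lemma integral_eq_zero_of_absolutelyContinuous {F k : ℝ → ℝ}
    (hF : ∀ M : ℝ, 0 ≤ M → AbsolutelyContinuousOnInterval F (-M) M)
    (hd : ∀ᵐ x, HasDerivAt F (k x) x) (hFi : Integrable F) (hk : Integrable k) :
    ∫ x, k x = 0 := by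
  have hsub : ∀ M : ℝ, 0 ≤ M → ∀ a ∈ Icc (-M) M, ∀ b ∈ Icc (-M) M,
      ∫ x in a..b, k x = F b - F a := by
    intro M hM a ha b hb
    rw [← uIcc_of_le (by linarith)] at ha hb
    rw [← ((hF M hM).mono (uIcc_subset_uIcc ha hb)).integral_deriv_eq_sub]
    apply intervalIntegral.integral_congr_ae
    filter_upwards [hd] with x hx _
    exact hx.deriv.symm
  have hF0 : ∀ b, F b = F 0 + ∫ x in (0 : ℝ)..b, k x := fun b => by
    rw [hsub |b| (abs_nonneg b) 0 ⟨by simp, by simp⟩ b ⟨neg_abs_le b, le_abs_self b⟩]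
    ring
  have htop : Tendsto F atTop (𝓝 (F 0 + ∫ x in Ioi 0, k x)) := by
    have := (intervalIntegral_tendsto_integral_Ioi 0 hk.integrableOn tendsto_id).const_add (F 0)
    exact this.congr fun b => (hF0 b).symm
  have hbot : Tendsto F atBot (𝓝 (F 0 - ∫ x in Iic 0, k x)) := by
    have := (intervalIntegral_tendsto_integral_Iic 0 hk.integrableOn tendsto_id).const_sub (F 0)
    refine this.congr fun b => ?_
    rw [hF0 b, intervalIntegral.integral_symm]
    simp
  have e1 : F 0 + ∫ x in Ioi 0, k x = 0 :=
    MeasureTheory.IntegrableAtFilter.eq_zero_of_tendsto (hFi.integrableAtFilter atTop)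
      (fun s hs => by
        obtain ⟨b, hb⟩ := mem_atTop_sets.1 hs
        rw [← top_le_iff, ← Real.volume_Ici (a := b)]
        exact measure_mono hb) htop
  have e2 : F 0 - ∫ x in Iic 0, k x = 0 :=
    MeasureTheory.IntegrableAtFilter.eq_zero_of_tendsto (hFi.integrableAtFilter atBot)
      (fun s hs => by
        obtain ⟨b, hb⟩ := mem_atBot_sets.1 hs
        rw [← top_le_iff, ← Real.volume_Iic (a := b)]
        exact measure_mono hb) hbot
  have := intervalIntegral.integral_Iic_add_Ioi (b := (0 : ℝ)) hk.integrableOn hk.integrableOn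
  linarith

lemma integrable_mul_mul {α f g : ℝ → ℝ} (hα : MemLp α ⊤ (volume : Measure ℝ))
    (hf : MemLp f 2 (volume : Measure ℝ)) (hg : MemLp g 2 (volume : Measure ℝ)) :
    Integrable fun x => α x * (f x * g x) := by
  have h1 : MemLp (fun x => f x * g x) 1 (volume : Measure ℝ) :=
    memLp_one_iff_integrable.2 (hf.integrable_mul hg)
  exact memLp_one_iff_integrable.1 (h1.mul hα)

lemma memLp_deriv_of_lipschitz {χ : ℝ → ℝ} {K : NNReal} (hχ : LipschitzWith K χ) :
    MemLp (deriv χ) ⊤ (volume : Measure ℝ) :=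
  memLp_top_of_bound (aestronglyMeasurable_deriv _ _) K
    (Eventually.of_forall fun _ => norm_deriv_le_of_lipschitz hχ)

/-- Integration by parts for two `H¹` functions against a bounded Lipschitz weight. -/
lemma integral_mul_weakDeriv_add {f g f' g' χ : ℝ → ℝ} {K : NNReal}
    (hf : HasWeakDeriv f f') (hg : HasWeakDeriv g g')
    (hf2 : MemLp f 2 (volume : Measure ℝ)) (hg2 : MemLp g 2 (volume : Measure ℝ))
    (hf2' : MemLp f' 2 (volume : Measure ℝ)) (hg2' : MemLp g' 2 (volume : Measure ℝ))
    (hχ : LipschitzWith K χ) (hχb : MemLp χ ⊤ (volume : Measure ℝ)) :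
    (∫ x, χ x * (f x * g' x)) + ∫ x, χ x * (f' x * g x) =
      - ∫ x, deriv χ x * (f x * g x) := by
  obtain ⟨C, hC⟩ := hf.exists_primitive
  obtain ⟨D, hD⟩ := hg.exists_primitive
  set F : ℝ → ℝ := fun x => C + ∫ t in (0 : ℝ)..x, f' t with hF
  set G : ℝ → ℝ := fun x => D + ∫ t in (0 : ℝ)..x, g' t with hG
  have i1 := integrable_mul_mul hχb hf2 hg2'
  have i2 := integrable_mul_mul hχb hf2' hg2
  have i3 := integrable_mul_mul (memLp_deriv_of_lipschitz hχ) hf2 hg2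
  have h := integral_eq_zero_of_absolutelyContinuous (F := fun x => χ x * (F x * G x))
    (k := fun x => χ x * (f x * g' x) + χ x * (f' x * g x) + deriv χ x * (f x * g x))
    (fun M hM => hχ.lipschitzOnWith.absolutelyContinuousOnInterval.mul
      ((absolutelyContinuousOnInterval_primitive hf.locInt_deriv C M hM).mul
        (absolutelyContinuousOnInterval_primitive hg.locInt_deriv D M hM))) ?_
    ((integrable_mul_mul hχb hf2 hg2).congr ?_) ((i1.add i2).add i3)
  · have i12 : Integrable fun x => χ x * (f x * g' x) + χ x * (f' x * g x) := i1.add i2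
    rw [integral_add i12 i3, integral_add i1 i2] at h
    linarith
  · filter_upwards [hC, hD, LocallyIntegrable.ae_hasDerivAt_integral hf.locInt_deriv,
      LocallyIntegrable.ae_hasDerivAt_integral hg.locInt_deriv,
      hχ.ae_differentiableAt_real] with x h1 h2 h3 h4 h5
    have := h5.hasDerivAt.mul (((h3 0).const_add C).mul ((h4 0).const_add D))
    refine this.congr_deriv ?_
    rw [h1, h2, Pi.mul_apply]
    ring
  · filter_upwards [hC, hD] with x h1 h2
    rw [h1, h2]

/-! ### Weighted quadratic forms and local conservation laws -/

/-- The symmetric bilinear form `(f, g) ↦ ∫ α f g` with weight `α`. -/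
def form (α f g : ℝ → ℝ) : ℝ := ∫ x, α x * (f x * g x)

lemma form_comm (α f g : ℝ → ℝ) : form α f g = form α g f := by
  simp only [form, mul_comm (f _)]

lemma exists_bilin_eq_form {α : ℝ → ℝ} (hα : MemLp α ⊤ (volume : Measure ℝ)) :
    ∃ B : L2 →L[ℝ] L2 →L[ℝ] ℝ, ∀ f g : L2, B f g = form α f g := by
  refine ⟨(ContinuousLinearMap.lpPairing volume 2 2 (ContinuousLinearMap.mul ℝ ℝ)).comp
    (((ContinuousLinearMap.mul ℝ ℝ).holderL volume ⊤ 2 2) hα.toLp), fun f g => ?_⟩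
  rw [ContinuousLinearMap.comp_apply, ContinuousLinearMap.lpPairing_eq_integral]
  refine integral_congr_ae ?_
  have h := ContinuousLinearMap.coeFn_holder (r := 2) (ContinuousLinearMap.mul ℝ ℝ) hα.toLp f
  filter_upwards [h, hα.coeFn_toLp] with x h1 h2
  have h3 : (((ContinuousLinearMap.mul ℝ ℝ).holderL volume ⊤ 2 2) hα.toLp f : L2) x =
    α x * f x := by rw [← h2]; exact h1
  rw [h3]
  simp [mul_assoc]

lemma continuousOn_form {α : ℝ → ℝ} (hα : MemLp α ⊤ (volume : Measure ℝ)) {f g : ℝ → L2}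
    {S : Set ℝ} (hf : ContinuousOn f S) (hg : ContinuousOn g S) :
    ContinuousOn (fun t => form α (f t) (g t)) S := by
  obtain ⟨B, hB⟩ := exists_bilin_eq_form hα
  simp only [← hB]
  exact (B.continuous.comp_continuousOn hf).clm_apply hg

lemma integrable_form {α : ℝ → ℝ} (hα : MemLp α ⊤ (volume : Measure ℝ)) (f g : L2) :
    Integrable fun x => α x * (f x * g x) :=
  integrable_mul_mul hα (Lp.memLp f) (Lp.memLp g)

/-- The pair `(P, Q) = (u_t, u_x)` satisfies the local conservation laws of energy and momentum
of the wave equation `κ u_tt = u_xx`, integrated in time and tested against Lipschitz weights. -/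
structure ConservationLaws (κ : ℝ → ℝ) (P Q : ℝ → L2) : Prop where
  continuousOn_fst : ContinuousOn P (Ici 0)
  continuousOn_snd : ContinuousOn Q (Ici 0)
  energy : ∀ (ψ : ℝ → ℝ) (K : NNReal), LipschitzWith K ψ → MemLp ψ ⊤ (volume : Measure ℝ) →
    ∀ s t, 0 ≤ s → s ≤ t →
    (form (ψ * κ) (P t) (P t) + form ψ (Q t) (Q t)) -
      (form (ψ * κ) (P s) (P s) + form ψ (Q s) (Q s)) =
      -2 * ∫ τ in s..t, form (deriv ψ) (P τ) (Q τ)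
  momentum : ∀ (χ : ℝ → ℝ) (K K' : NNReal), LipschitzWith K χ → LipschitzWith K' (χ * κ) →
    MemLp χ ⊤ (volume : Measure ℝ) → MemLp (χ * κ) ⊤ (volume : Measure ℝ) →
    ∀ s t, 0 ≤ s → s ≤ t →
    form (χ * κ) (P t) (Q t) - form (χ * κ) (P s) (Q s) =
      -(1 / 2) * ∫ τ in s..t,
        (form (deriv χ) (Q τ) (Q τ) + form (deriv (χ * κ)) (P τ) (P τ))

/-- A solution `p_x = q_t`, `q_x = κ p_t` of the first order system, with `p` and `q` continuously
differentiable in time as `L²`-valued functions. -/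
structure IsStrongSolution (κ : ℝ → ℝ) (p q p' q' : ℝ → L2) : Prop where
  hasDeriv_fst : ∀ t, 0 ≤ t → HasDerivWithinAt p (p' t) (Ici 0) t
  hasDeriv_snd : ∀ t, 0 ≤ t → HasDerivWithinAt q (q' t) (Ici 0) t
  continuousOn_fst : ContinuousOn p' (Ici 0)
  continuousOn_snd : ContinuousOn q' (Ici 0)
  weakDeriv_fst : ∀ t, 0 ≤ t → HasWeakDeriv (p t) (q' t)
  weakDeriv_snd : ∀ t, 0 ≤ t → HasWeakDeriv (q t) fun x => κ x * p' t x

lemma intervalIntegral_eq_sub_of_hasDerivWithinAt_Ici {f f' : ℝ → ℝ}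
    (hf : ∀ t, 0 ≤ t → HasDerivWithinAt f (f' t) (Ici 0) t) (hf' : ContinuousOn f' (Ici 0))
    {s t : ℝ} (hs : 0 ≤ s) (hst : s ≤ t) : ∫ τ in s..t, f' τ = f t - f s := by
  have hsub : uIcc s t ⊆ Ici 0 := by
    rw [uIcc_of_le hst]
    exact fun x hx => hs.trans hx.1
  refine intervalIntegral.integral_eq_sub_of_hasDeriv_right
    (fun x hx => ((hf x (hsub hx)).continuousWithinAt).mono hsub) (fun x hx => ?_)
    (hf'.mono hsub).intervalIntegrable
  rw [min_eq_left hst] at hx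
  have hx0 : 0 ≤ x := hs.trans hx.1.le
  exact (hf x hx0).mono fun y hy => hx0.trans (le_of_lt hy)

/-- Integration by parts in terms of `form`; the source of both conservation laws. -/
lemma form_weakDeriv_add {f g : L2} {f' g' χ : ℝ → ℝ} {K : NNReal}
    (hf : HasWeakDeriv f f') (hg : HasWeakDeriv g g')
    (hf2' : MemLp f' 2 (volume : Measure ℝ)) (hg2' : MemLp g' 2 (volume : Measure ℝ))
    (hχ : LipschitzWith K χ) (hχb : MemLp χ ⊤ (volume : Measure ℝ)) :
    form χ f g' + form χ f' g = - form (deriv χ) f g :=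
  integral_mul_weakDeriv_add hf hg (Lp.memLp f) (Lp.memLp g) hf2' hg2' hχ hχb

lemma form_mul_right (α κ f g : ℝ → ℝ) : form α f (fun x => κ x * g x) = form (α * κ) f g := by
  refine integral_congr_ae (Eventually.of_forall fun x => ?_)
  simp only [Pi.mul_apply]
  ring

theorem IsStrongSolution.conservationLaws {κ : ℝ → ℝ} {p q p' q' : ℝ → L2}
    (h : IsStrongSolution κ p q p' q') (hκ : MemLp κ ⊤ (volume : Measure ℝ)) :
    ConservationLaws κ p q := by
  have hp : ContinuousOn p (Ici 0) := fun t ht => (h.hasDeriv_fst t ht).continuousWithinAt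
  have hq : ContinuousOn q (Ici 0) := fun t ht => (h.hasDeriv_snd t ht).continuousWithinAt
  have hκp : ∀ t, MemLp (fun x => κ x * p' t x) 2 (volume : Measure ℝ) := fun t =>
    (Lp.memLp (p' t)).mul hκ
  refine ⟨hp, hq, fun ψ K hψ hψb s t hs hst => ?_, fun χ K K' hχ hχκ hχb hχκb s t hs hst => ?_⟩
  · have hψκ : MemLp (ψ * κ) ⊤ (volume : Measure ℝ) := hκ.mul hψb
    obtain ⟨A, hA⟩ := exists_bilin_eq_form hψκ
    obtain ⟨B, hB⟩ := exists_bilin_eq_form hψb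
    rw [← intervalIntegral.integral_const_mul]
    symm
    refine intervalIntegral_eq_sub_of_hasDerivWithinAt_Ici (f := fun t =>
      form (ψ * κ) (p t) (p t) + form ψ (q t) (q t)) (fun τ hτ => ?_)
      (continuousOn_const.mul (continuousOn_form (memLp_deriv_of_lipschitz hψ) hp hq)) hs hst
    have h1 := (A.hasDerivWithinAt_of_bilinear (h.hasDeriv_fst τ hτ) (h.hasDeriv_fst τ hτ)).add
      (B.hasDerivWithinAt_of_bilinear (h.hasDeriv_snd τ hτ) (h.hasDeriv_snd τ hτ))
    simp only [hA, hB] at h1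
    refine h1.congr_deriv ?_
    have h2 := form_weakDeriv_add (h.weakDeriv_fst τ hτ) (h.weakDeriv_snd τ hτ)
      (Lp.memLp (q' τ)) (hκp τ) hψ hψb
    rw [form_mul_right] at h2
    rw [form_comm _ (p' τ), form_comm _ (q τ) (q' τ)]
    simp only [Pi.mul_apply]
    linarith
  · obtain ⟨A, hA⟩ := exists_bilin_eq_form hχκb
    rw [← intervalIntegral.integral_const_mul]
    symm
    refine intervalIntegral_eq_sub_of_hasDerivWithinAt_Ici (f := fun t =>
      form (χ * κ) (p t) (q t)) (fun τ hτ => ?_)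
      (continuousOn_const.mul ((continuousOn_form (memLp_deriv_of_lipschitz hχ) hq hq).add
        (continuousOn_form (memLp_deriv_of_lipschitz hχκ) hp hp))) hs hst
    have h1 := A.hasDerivWithinAt_of_bilinear (h.hasDeriv_fst τ hτ) (h.hasDeriv_snd τ hτ)
    simp only [hA] at h1
    refine h1.congr_deriv ?_
    have h2 := form_weakDeriv_add (h.weakDeriv_fst τ hτ) (h.weakDeriv_fst τ hτ)
      (Lp.memLp (q' τ)) (Lp.memLp (q' τ)) hχκ hχκb
    have h3 := form_weakDeriv_add (h.weakDeriv_snd τ hτ) (h.weakDeriv_snd τ hτ)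
      (hκp τ) (hκp τ) hχ hχb
    rw [form_comm _ (q' τ)] at h2
    rw [form_comm _ (fun x => κ x * p' τ x), form_mul_right] at h3
    rw [form_comm _ (p' τ)]
    simp only [Pi.mul_apply, Pi.add_apply]
    linarith

lemma tendsto_form {ι : Type*} {l : Filter ι} {α : ℝ → ℝ} (hα : MemLp α ⊤ (volume : Measure ℝ))
    {f g : ι → L2} {f₀ g₀ : L2} (hf : Tendsto f l (𝓝 f₀)) (hg : Tendsto g l (𝓝 g₀)) :
    Tendsto (fun n => form α (f n) (g n)) l (𝓝 (form α f₀ g₀)) := by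
  obtain ⟨B, hB⟩ := exists_bilin_eq_form hα
  simp only [← hB]
  exact (B.continuous₂.tendsto (f₀, g₀)).comp (hf.prodMk_nhds hg)

lemma tendsto_intervalIntegral_form {ι : Type*} {l : Filter ι} [l.IsCountablyGenerated]
    {α : ℝ → ℝ} (hα : MemLp α ⊤ (volume : Measure ℝ)) {f g : ι → ℝ → L2} {f₀ g₀ : ℝ → L2}
    (hfc : ∀ᶠ n in l, ContinuousOn (f n) (Ici 0)) (hgc : ∀ᶠ n in l, ContinuousOn (g n) (Ici 0))
    (hf : ∀ t, 0 ≤ t → Tendsto (fun n => f n t) l (𝓝 (f₀ t)))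
    (hg : ∀ t, 0 ≤ t → Tendsto (fun n => g n t) l (𝓝 (g₀ t)))
    {s t M : ℝ} (hs : 0 ≤ s) (hst : s ≤ t) (hfb : ∀ᶠ n in l, ∀ τ ∈ Icc 0 t, ‖f n τ‖ ≤ M)
    (hgb : ∀ᶠ n in l, ∀ τ ∈ Icc 0 t, ‖g n τ‖ ≤ M) :
    Tendsto (fun n => ∫ τ in s..t, form α (f n τ) (g n τ)) l
      (𝓝 (∫ τ in s..t, form α (f₀ τ) (g₀ τ))) := by
  have hsub : uIoc s t ⊆ Ici 0 := by
    rw [uIoc_of_le hst]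
    exact fun x hx => hs.trans hx.1.le
  obtain ⟨B, hB⟩ := exists_bilin_eq_form hα
  refine intervalIntegral.tendsto_integral_filter_of_dominated_convergence
    (fun _ => ‖B‖ * M * M) ?_ ?_ intervalIntegrable_const ?_
  · filter_upwards [hfc, hgc] with n h1 h2
    exact ((continuousOn_form hα h1 h2).mono hsub).aestronglyMeasurable measurableSet_uIoc
  · filter_upwards [hfb, hgb] with n h1 h2
    refine Eventually.of_forall fun τ hτ => ?_
    rw [uIoc_of_le hst] at hτ
    have hτ' : τ ∈ Icc 0 t := ⟨hs.trans hτ.1.le, hτ.2⟩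
    rw [← hB]
    have hM : 0 ≤ M := (norm_nonneg _).trans (h1 τ hτ')
    refine (B.le_opNorm₂ _ _).trans ?_
    gcongr
    · exact h1 τ hτ'
    · exact h2 τ hτ'
  · exact Eventually.of_forall fun τ hτ => tendsto_form hα (hf τ (mem_Ici.1 (hsub hτ)))
      (hg τ (mem_Ici.1 (hsub hτ)))

theorem ConservationLaws.of_tendsto {ι : Type*} {l : Filter ι} [l.IsCountablyGenerated] [l.NeBot]
    {κ : ℝ → ℝ} (hκ : MemLp κ ⊤ (volume : Measure ℝ)) {p q : ι → ℝ → L2} {P Q : ℝ → L2}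
    (h : ∀ᶠ n in l, ConservationLaws κ (p n) (q n))
    (hP : ContinuousOn P (Ici 0)) (hQ : ContinuousOn Q (Ici 0))
    (hp : ∀ t, 0 ≤ t → Tendsto (fun n => p n t) l (𝓝 (P t)))
    (hq : ∀ t, 0 ≤ t → Tendsto (fun n => q n t) l (𝓝 (Q t)))
    (hpb : ∀ t, 0 ≤ t → ∃ M, ∀ᶠ n in l, ∀ τ ∈ Icc 0 t, ‖p n τ‖ ≤ M)
    (hqb : ∀ t, 0 ≤ t → ∃ M, ∀ᶠ n in l, ∀ τ ∈ Icc 0 t, ‖q n τ‖ ≤ M) :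
    ConservationLaws κ P Q := by
  have hpc := h.mono fun n hn => hn.continuousOn_fst
  have hqc := h.mono fun n hn => hn.continuousOn_snd
  have hb : ∀ t, 0 ≤ t → ∃ M, (∀ᶠ n in l, ∀ τ ∈ Icc 0 t, ‖p n τ‖ ≤ M) ∧
      ∀ᶠ n in l, ∀ τ ∈ Icc 0 t, ‖q n τ‖ ≤ M := fun t ht => by
    obtain ⟨M, hM⟩ := hpb t ht
    obtain ⟨N, hN⟩ := hqb t ht
    exact ⟨max M N, hM.mono fun n hn τ hτ => (hn τ hτ).trans (le_max_left _ _),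
      hN.mono fun n hn τ hτ => (hn τ hτ).trans (le_max_right _ _)⟩
  refine ⟨hP, hQ, fun ψ K hψ hψb s t hs hst => ?_, fun χ K K' hχ hχκ hχb hχκb s t hs hst => ?_⟩
  · have ht := hs.trans hst
    obtain ⟨M, hM, hN⟩ := hb t ht
    have hψκ : MemLp (ψ * κ) ⊤ (volume : Measure ℝ) := hκ.mul hψb
    refine tendsto_nhds_unique (((tendsto_form hψκ (hp t ht) (hp t ht)).add
      (tendsto_form hψb (hq t ht) (hq t ht))).sub ((tendsto_form hψκ (hp s hs) (hp s hs)).add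
      (tendsto_form hψb (hq s hs) (hq s hs)))) ?_
    refine ((tendsto_intervalIntegral_form (memLp_deriv_of_lipschitz hψ) hpc hqc hp hq hs hst
      hM hN).const_mul (-2)).congr' ?_
    filter_upwards [h] with n hn
    exact (hn.energy ψ K hψ hψb s t hs hst).symm
  · have ht := hs.trans hst
    obtain ⟨M, hM, hN⟩ := hb t ht
    have hsub : uIcc s t ⊆ Ici 0 := by
      rw [uIcc_of_le hst]
      exact fun x hx => hs.trans hx.1
    have hii : ∀ {α : ℝ → ℝ} {f : ℝ → L2}, MemLp α ⊤ (volume : Measure ℝ) →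
        ContinuousOn f (Ici 0) →
        IntervalIntegrable (fun τ => form α (f τ) (f τ)) volume s t := fun hα hf =>
      ((continuousOn_form hα hf hf).mono hsub).intervalIntegrable
    have d1 := memLp_deriv_of_lipschitz hχ
    have d2 := memLp_deriv_of_lipschitz hχκ
    refine tendsto_nhds_unique ((tendsto_form hχκb (hp t ht) (hq t ht)).sub
      (tendsto_form hχκb (hp s hs) (hq s hs))) ?_
    rw [intervalIntegral.integral_add (hii d1 hQ) (hii d2 hP)]
    refine (((tendsto_intervalIntegral_form d1 hqc hqc hq hq hs hst hN hN).add
      (tendsto_intervalIntegral_form d2 hpc hpc hp hp hs hst hM hM)).const_mul _).congr' ?_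
    filter_upwards [h] with n hn
    rw [hn.momentum χ K K' hχ hχκ hχb hχκb s t hs hst,
      intervalIntegral.integral_add (hii d1 hn.continuousOn_snd) (hii d2 hn.continuousOn_fst)]

/-! ### Weak solutions and Steklov averages -/

/-- The difference quotient `h⁻¹ • (V (t + h) - V t)` is the average of `V'` over `[t, t + h]`, and
it has one more time derivative than `V'`. -/
lemma hasDerivWithinAt_steklov {V V' : ℝ → L2}
    (hV : ∀ t, 0 ≤ t → HasDerivWithinAt V (V' t) (Ici 0) t) {h : ℝ} (hh : 0 < h) {t : ℝ}
    (ht : 0 ≤ t) :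
    HasDerivWithinAt (fun t => h⁻¹ • (V (t + h) - V t)) (h⁻¹ • (V' (t + h) - V' t)) (Ici 0) t := by
  have h1 : HasDerivWithinAt (fun t => V (t + h)) (V' (t + h)) (Ici 0) t := by
    have := (hV (t + h) (by linarith)).scomp t
      ((hasDerivWithinAt_id t (Ici 0)).add_const h) (fun x (hx : 0 ≤ x) => by
        simp only [id, mem_Ici]; linarith)
    rw [one_smul] at this
    exact this
  exact (h1.sub (hV t ht)).const_smul h⁻¹

lemma continuousOn_steklov {V : ℝ → L2} (hV : ContinuousOn V (Ici 0)) {h : ℝ} (hh : 0 < h) :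
    ContinuousOn (fun t => h⁻¹ • (V (t + h) - V t)) (Ici 0) := by
  refine ContinuousOn.const_smul (ContinuousOn.sub ?_ hV) h⁻¹
  exact hV.comp (by fun_prop) fun x (hx : 0 ≤ x) => by simp only [mem_Ici]; linarith

lemma tendsto_steklov {V : ℝ → L2} {V' : L2} {t : ℝ} (ht : 0 ≤ t)
    (hV : HasDerivWithinAt V V' (Ici 0) t) :
    Tendsto (fun h : ℝ => h⁻¹ • (V (t + h) - V t)) (𝓝[>] 0) (𝓝 V') := by
  have h1 : HasDerivWithinAt V V' (Ioi t) t := hV.mono fun x hx => ht.trans (le_of_lt hx)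
  rw [hasDerivWithinAt_iff_tendsto_slope' (by simp)] at h1
  have h2 : Tendsto (fun h : ℝ => t + h) (𝓝[>] 0) (𝓝[>] t) := by
    have h3 : Tendsto (fun h : ℝ => t + h) (𝓝[>] 0) (𝓝 t) := by
      have : Continuous fun h : ℝ => t + h := by fun_prop
      simpa using (this.tendsto 0).mono_left nhdsWithin_le_nhds
    refine tendsto_nhdsWithin_iff.2 ⟨h3, ?_⟩
    filter_upwards [self_mem_nhdsWithin] with h (hh : 0 < h)
    exact lt_add_of_pos_right t hh
  refine (h1.comp h2).congr fun h => ?_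
  simp [slope_def_module]

lemma norm_steklov_le {V V' : ℝ → L2}
    (hV : ∀ t, 0 ≤ t → HasDerivWithinAt V (V' t) (Ici 0) t) (hV' : ContinuousOn V' (Ici 0))
    (t : ℝ) :
    ∃ M, ∀ᶠ h in 𝓝[>] (0 : ℝ), ∀ τ ∈ Icc 0 t, ‖h⁻¹ • (V (τ + h) - V τ)‖ ≤ M := by
  obtain ⟨M, hM⟩ := isCompact_Icc.exists_bound_of_continuousOn
    (hV'.mono (Icc_subset_Ici_self : Icc 0 (t + 1) ⊆ Ici 0))
  refine ⟨M, ?_⟩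
  filter_upwards [Ioo_mem_nhdsGT (zero_lt_one' ℝ)] with h hh τ hτ
  have h0 : 0 < h := hh.1
  have := (convex_Icc (0 : ℝ) (t + 1)).norm_image_sub_le_of_norm_hasDerivWithin_le (f := V)
    (fun x hx => (hV x hx.1).mono Icc_subset_Ici_self) hM
    (x := τ) (y := τ + h) ⟨hτ.1, by linarith [hτ.2]⟩ ⟨by linarith [hτ.1], by linarith [hτ.2, hh.2]⟩
  rw [norm_smul, norm_inv, Real.norm_of_nonneg h0.le, inv_mul_le_iff₀ h0]
  simpa [abs_of_pos h0, mul_comm] using this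

lemma HasWeakDeriv.steklov {f₁ f₂ g₁ g₂ : L2} (h₁ : HasWeakDeriv f₁ g₁) (h₂ : HasWeakDeriv f₂ g₂)
    (a : ℝ) : HasWeakDeriv (a • (f₁ - f₂) : L2) (a • (g₁ - g₂) : L2) := by
  have hl : ∀ f : L2, LocallyIntegrable f volume := fun f =>
    (Lp.memLp f).locallyIntegrable (by norm_num)
  have hae : ∀ f g : L2, ∀ᵐ x, (a • (f - g) : L2) x = a * (f x - g x) := fun f g => by
    filter_upwards [Lp.coeFn_smul a (f - g), Lp.coeFn_sub f g] with x h1 h2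
    rw [h1, Pi.smul_apply, h2, Pi.sub_apply, smul_eq_mul]
  have hi : ∀ (f : L2) {φ : ℝ → ℝ}, Continuous φ → HasCompactSupport φ →
      Integrable fun x => f x * φ x := fun f φ hφ hc => by
    simpa [mul_comm] using (hl f).integrable_smul_left_of_hasCompactSupport hφ hc
  have hint : ∀ (f g : L2) {φ : ℝ → ℝ}, Continuous φ → HasCompactSupport φ →
      ∫ x, (a • (f - g) : L2) x * φ x = a * ((∫ x, f x * φ x) - ∫ x, g x * φ x) := by
    intro f g φ hφ hc
    rw [← integral_sub (hi f hφ hc) (hi g hφ hc), ← integral_const_mul]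
    refine integral_congr_ae ?_
    filter_upwards [hae f g] with x hx
    rw [hx]
    ring
  refine ⟨hl _, hl _, fun φ hφ hc => ?_⟩
  rw [hint _ _ (hφ.continuous_deriv (by simp)) hc.deriv, hint _ _ hφ.continuous hc,
    h₁.integral_eq φ hφ hc, h₂.integral_eq φ hφ hc]
  ring

lemma exists_clm_eq_integral_mul {φ : ℝ → ℝ} (hφ : Continuous φ) (hc : HasCompactSupport φ) :
    ∃ ℓ : L2 →L[ℝ] ℝ, ∀ f : L2, ℓ f = ∫ x, f x * φ x := by
  have hm : MemLp φ 2 (volume : Measure ℝ) := hφ.memLp_of_hasCompactSupport hc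
  refine ⟨innerSL ℝ hm.toLp, fun f => ?_⟩
  rw [innerSL_apply_apply, L2.inner_def]
  refine integral_congr_ae ?_
  filter_upwards [hm.coeFn_toLp] with x hx
  rw [hx]
  simp

/-- Averaging a weak solution over the time interval `[t, t + h]` produces a strong solution. -/
theorem IsWeakSolution.isStrongSolution_steklov {c κ : ℝ → ℝ} {u₀ u₁ : L2} {u ux ut U : ℝ → L2}
    (hu : IsWeakSolution c u₀ u₁ u ux ut) (hκ : MemLp κ ⊤ (volume : Measure ℝ))
    (hκc : ∀ᵐ x, κ x = 1 / c x ^ 2)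
    (hU : ∀ s t, 0 ≤ s → s ≤ t → U t - U s = ∫ τ in s..t, ux τ)
    (hU' : ∀ t, 0 ≤ t → HasDerivWithinAt U (ux t) (Ici 0) t) {h : ℝ} (hh : 0 < h) :
    IsStrongSolution κ (fun t => h⁻¹ • (u (t + h) - u t)) (fun t => h⁻¹ • (U (t + h) - U t))
      (fun t => h⁻¹ • (ut (t + h) - ut t)) (fun t => h⁻¹ • (ux (t + h) - ux t)) where
  hasDeriv_fst t ht := hasDerivWithinAt_steklov hu.regularity.hasDeriv hh ht
  hasDeriv_snd t ht := hasDerivWithinAt_steklov hU' hh ht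
  continuousOn_fst := continuousOn_steklov hu.regularity.continuousOn_ut hh
  continuousOn_snd := continuousOn_steklov hu.regularity.continuousOn_ux hh
  weakDeriv_fst t ht := (hu.regularity.weakDeriv (t + h) (by linarith)).steklov
    (hu.regularity.weakDeriv t ht) _
  weakDeriv_snd t ht := by
    have hκp : ∀ f : L2, MemLp (fun x => κ x * f x) 2 (volume : Measure ℝ) := fun f =>
      (Lp.memLp f).mul hκ
    refine ⟨(Lp.memLp _).locallyIntegrable (by norm_num),
      (hκp _).locallyIntegrable (by norm_num), fun φ hφ hc => ?_⟩
    have hd : Continuous (deriv φ) := hφ.continuous_deriv (by simp)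
    obtain ⟨ℓ, hℓ⟩ := exists_clm_eq_integral_mul hd hc.deriv
    have hsub : uIcc t (t + h) ⊆ Ici 0 := by
      rw [uIcc_of_le (by linarith)]
      exact fun x hx => ht.trans hx.1
    have hint : IntervalIntegrable ux volume t (t + h) :=
      (hu.regularity.continuousOn_ux.mono hsub).intervalIntegrable
    have e1 : ∫ τ in t..(t + h), -∫ x, ux τ x * deriv φ x =
        (∫ x, 1 / c x ^ 2 * ut (t + h) x * φ x) - ∫ x, 1 / c x ^ 2 * ut t x * φ x :=
      intervalIntegral_eq_sub_of_hasDerivWithinAt_Ici (fun τ hτ => hu.equation φ hφ hc τ hτ)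
        (by
          simp only [← hℓ]
          exact (ℓ.continuous.comp_continuousOn hu.regularity.continuousOn_ux).neg)
        ht (by linarith)
    have e2 : ∀ f : L2, Integrable fun x => 1 / c x ^ 2 * f x * φ x := fun f => by
      have := ((hκp f).locallyIntegrable (by norm_num)).integrable_smul_left_of_hasCompactSupport
        hφ.continuous hc
      refine this.congr ?_
      filter_upwards [hκc] with x hx
      rw [hx, smul_eq_mul]
      ring
    rw [← hℓ, map_smul, hU t (t + h) ht (by linarith), ← ℓ.intervalIntegral_comp_comm hint]
    simp only [hℓ]
    rw [intervalIntegral.integral_neg, ← integral_sub (e2 _) (e2 _)] at e1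
    rw [smul_eq_mul, ← neg_eq_iff_eq_neg.2 e1.symm, mul_neg, ← integral_const_mul]
    congr 1
    refine integral_congr_ae ?_
    filter_upwards [hκc, Lp.coeFn_smul h⁻¹ (ut (t + h) - ut t),
      Lp.coeFn_sub (ut (t + h)) (ut t)] with x h1 h2 h3
    rw [h1, h2, Pi.smul_apply, h3, Pi.sub_apply, smul_eq_mul]
    ring

theorem IsWeakSolution.conservationLaws {c κ : ℝ → ℝ} {u₀ u₁ : L2} {u ux ut : ℝ → L2}
    (hu : IsWeakSolution c u₀ u₁ u ux ut) (hκ : MemLp κ ⊤ (volume : Measure ℝ))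
    (hκc : ∀ᵐ x, κ x = 1 / c x ^ 2) : ConservationLaws κ ut ux := by
  have hux := hu.regularity.continuousOn_ux
  have hut := hu.regularity.continuousOn_ut
  -- Extending `u_x` by a constant to negative times makes its primitive differentiable everywhere.
  have hv : Continuous fun t => ux (max t 0) :=
    hux.comp_continuous (by fun_prop) fun t => le_max_right t 0
  set U : ℝ → L2 := fun t => ∫ τ in (0 : ℝ)..t, ux (max τ 0) with hUdef
  have hU : ∀ s t, 0 ≤ s → s ≤ t → U t - U s = ∫ τ in s..t, ux τ := fun s t hs hst => by
    rw [hUdef]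
    simp only
    rw [intervalIntegral.integral_interval_sub_left (hv.intervalIntegrable _ _)
      (hv.intervalIntegrable _ _)]
    refine intervalIntegral.integral_congr fun τ hτ => ?_
    rw [uIcc_of_le hst] at hτ
    simp only [max_eq_left (hs.trans hτ.1)]
  have hU' : ∀ t, 0 ≤ t → HasDerivWithinAt U (ux t) (Ici 0) t := fun t ht => by
    have := (hv.integral_hasStrictDerivAt 0 t).hasDerivAt.hasDerivWithinAt (s := Ici 0)
    rwa [max_eq_left ht] at this
  refine ConservationLaws.of_tendsto (l := 𝓝[>] (0 : ℝ)) hκ ?_ hut hux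
    (fun t ht => tendsto_steklov ht (hu.regularity.hasDeriv t ht))
    (fun t ht => tendsto_steklov ht (hU' t ht))
    (fun t _ => norm_steklov_le hu.regularity.hasDeriv hut t)
    (fun t _ => norm_steklov_le hU' hux t)
  filter_upwards [self_mem_nhdsWithin] with h hh
  exact (hu.isStrongSolution_steklov hκ hκc hU hU' hh).conservationLaws hκ

/-! ### Weighted energies -/

/-- The energy density `½ (κ f² + g²)`. -/
def energyDensity (κ f g : ℝ → ℝ) (x : ℝ) : ℝ := (κ x * f x ^ 2 + g x ^ 2) / 2

/-- The energy `½ ∫ α (κ f² + g²)` with weight `α`. -/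
def weightedEnergy (κ α f g : ℝ → ℝ) : ℝ := ∫ x, α x * energyDensity κ f g x

/-- The hypotheses on the coefficient `κ = c⁻²` of the equation `κ u_tt = u_xx` under which local
energy decays: `κ` is positive and Lipschitz, `κ = 1` outside `[-L, L]`, `√κ = 1 / c` is bounded
by `K`, and the relative variation `L |κ'| / κ` is bounded by `η`. -/
structure IsCoefficient (κ : ℝ → ℝ) (L K η : ℝ) : Prop where
  L_pos : 0 < L
  K_nonneg : 0 ≤ K
  pos : ∀ x, 0 < κ x
  le : ∀ x, κ x ≤ K ^ 2
  lipschitz : ∃ C : NNReal, LipschitzWith C κ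
  eq_one : ∀ x, L < |x| → κ x = 1
  deriv_le : ∀ᵐ x, L * |deriv κ x| ≤ η * κ x

section

variable {κ : ℝ → ℝ} {L K η : ℝ}

lemma IsCoefficient.memLp (hκ : IsCoefficient κ L K η) : MemLp κ ⊤ (volume : Measure ℝ) := by
  obtain ⟨C, hC⟩ := hκ.lipschitz
  refine memLp_top_of_bound hC.continuous.aestronglyMeasurable (K ^ 2)
    (Eventually.of_forall fun x => ?_)
  rw [Real.norm_of_nonneg (hκ.pos x).le]
  exact hκ.le x

lemma IsCoefficient.energyDensity_nonneg (hκ : IsCoefficient κ L K η) (f g : ℝ → ℝ) (x : ℝ) :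
    0 ≤ energyDensity κ f g x := by
  have := (hκ.pos x).le
  unfold energyDensity
  positivity

lemma integrable_weightedEnergy (hκ : MemLp κ ⊤ (volume : Measure ℝ)) {α : ℝ → ℝ}
    (hα : MemLp α ⊤ (volume : Measure ℝ)) (f g : L2) :
    Integrable fun x => α x * energyDensity κ f g x := by
  have h1 := integrable_form (hκ.mul hα : MemLp (α * κ) ⊤ volume) f f
  have h2 := integrable_form hα g g
  refine ((h1.add h2).div_const 2).congr (Eventually.of_forall fun x => ?_)
  simp only [Pi.add_apply, Pi.mul_apply, energyDensity]
  ring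

lemma weightedEnergy_eq_form (hκ : MemLp κ ⊤ (volume : Measure ℝ)) {α : ℝ → ℝ}
    (hα : MemLp α ⊤ (volume : Measure ℝ)) (f g : L2) :
    weightedEnergy κ α f g = (form (α * κ) f f + form α g g) / 2 := by
  have h1 := integrable_form (hκ.mul hα : MemLp (α * κ) ⊤ volume) f f
  have h2 := integrable_form hα g g
  rw [form, form, ← integral_add h1 h2, ← integral_div]
  refine integral_congr_ae (Eventually.of_forall fun x => ?_)
  simp only [Pi.mul_apply, energyDensity]
  ring

lemma continuousOn_weightedEnergy (hκ : MemLp κ ⊤ (volume : Measure ℝ)) {α : ℝ → ℝ}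
    (hα : MemLp α ⊤ (volume : Measure ℝ)) {P Q : ℝ → L2} {S : Set ℝ}
    (hP : ContinuousOn P S) (hQ : ContinuousOn Q S) :
    ContinuousOn (fun t => weightedEnergy κ α (P t) (Q t)) S := by
  simp only [weightedEnergy_eq_form hκ hα]
  exact ((continuousOn_form (hκ.mul hα) hP hP).add (continuousOn_form hα hQ hQ)).div_const 2

lemma IsCoefficient.weightedEnergy_mono (hκ : IsCoefficient κ L K η) {α β : ℝ → ℝ}
    (hα : MemLp α ⊤ (volume : Measure ℝ)) (hβ : MemLp β ⊤ (volume : Measure ℝ))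
    (h : ∀ x, α x ≤ β x) (f g : L2) : weightedEnergy κ α f g ≤ weightedEnergy κ β f g :=
  integral_mono (integrable_weightedEnergy hκ.memLp hα f g)
    (integrable_weightedEnergy hκ.memLp hβ f g)
    fun x => mul_le_mul_of_nonneg_right (h x) (hκ.energyDensity_nonneg _ _ x)

lemma IsCoefficient.weightedEnergy_nonneg (hκ : IsCoefficient κ L K η) {α : ℝ → ℝ}
    (h : ∀ x, 0 ≤ α x) (f g : L2) : 0 ≤ weightedEnergy κ α f g :=
  integral_nonneg fun x => mul_nonneg (h x) (hκ.energyDensity_nonneg _ _ x)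

lemma weightedEnergy_add (hκ : MemLp κ ⊤ (volume : Measure ℝ)) {α β : ℝ → ℝ}
    (hα : MemLp α ⊤ (volume : Measure ℝ)) (hβ : MemLp β ⊤ (volume : Measure ℝ)) (f g : L2) :
    weightedEnergy κ (fun x => α x + β x) f g =
      weightedEnergy κ α f g + weightedEnergy κ β f g := by
  simp only [weightedEnergy, add_mul]
  exact integral_add (integrable_weightedEnergy hκ hα f g) (integrable_weightedEnergy hκ hβ f g)

lemma weightedEnergy_const_mul (a : ℝ) (α f g : ℝ → ℝ) :
    weightedEnergy κ (fun x => a * α x) f g = a * weightedEnergy κ α f g := by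
  simp only [weightedEnergy, mul_assoc]
  exact integral_const_mul _ _

/-- The flux is controlled by the energy: `|f g| √κ ≤ ½ (κ f² + g²)`. -/
lemma IsCoefficient.abs_form_le (hκ : IsCoefficient κ L K η) {α β : ℝ → ℝ}
    (hα : MemLp α ⊤ (volume : Measure ℝ)) (hβ : MemLp β ⊤ (volume : Measure ℝ))
    (h : ∀ x, |β x| ≤ α x * √(κ x)) (f g : L2) : |form β f g| ≤ weightedEnergy κ α f g := by
  refine (abs_integral_le_integral_abs).trans
    (integral_mono (integrable_form hβ f g).abs (integrable_weightedEnergy hκ.memLp hα f g)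
      fun x => ?_)
  have h0 := Real.sqrt_pos.2 (hκ.pos x)
  have h1 := Real.sq_sqrt (hκ.pos x).le
  have hα0 : 0 ≤ α x := nonneg_of_mul_nonneg_left ((abs_nonneg _).trans (h x)) h0
  simp only [energyDensity]
  rw [abs_mul, abs_mul, ← sq_abs (f x), ← sq_abs (g x)]
  calc |β x| * (|f x| * |g x|) ≤ α x * √(κ x) * (|f x| * |g x|) := by gcongr; exact h x
    _ = α x * ((√(κ x) * |f x|) * |g x|) := by ring
    _ ≤ α x * ((κ x * |f x| ^ 2 + |g x| ^ 2) / 2) := by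
      refine mul_le_mul_of_nonneg_left ?_ hα0
      have := two_mul_le_add_sq (√(κ x) * |f x|) |g x|
      rw [mul_pow, h1] at this
      linarith

/-- In the region `|x| > L`, where the wave speed is one, the flux is at most the energy
density. -/
lemma IsCoefficient.abs_form_le_of_eq_zero (hκ : IsCoefficient κ L K η) {α β : ℝ → ℝ}
    (hα : MemLp α ⊤ (volume : Measure ℝ)) (hβ : MemLp β ⊤ (volume : Measure ℝ))
    (hα0 : ∀ x, 0 ≤ α x) (h : ∀ x, |β x| ≤ α x) (h0 : ∀ x, |x| ≤ L → β x = 0) (f g : L2) :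
    |form β f g| ≤ weightedEnergy κ α f g := by
  refine hκ.abs_form_le hα hβ (fun x => ?_) f g
  rcases le_or_gt |x| L with hx | hx
  · rw [h0 x hx, abs_zero]
    exact mul_nonneg (hα0 x) (Real.sqrt_nonneg _)
  · rw [hκ.eq_one x hx, Real.sqrt_one, mul_one]
    exact h x

lemma ConservationLaws.weightedEnergy_sub {P Q : ℝ → L2} (h : ConservationLaws κ P Q)
    (hκ : MemLp κ ⊤ (volume : Measure ℝ)) {ψ : ℝ → ℝ} {C : NNReal} (hψ : LipschitzWith C ψ)
    (hψb : MemLp ψ ⊤ (volume : Measure ℝ)) {s t : ℝ} (hs : 0 ≤ s) (hst : s ≤ t) :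
    weightedEnergy κ ψ (P t) (Q t) - weightedEnergy κ ψ (P s) (Q s) =
      - ∫ τ in s..t, form (deriv ψ) (P τ) (Q τ) := by
  rw [weightedEnergy_eq_form hκ hψb, weightedEnergy_eq_form hκ hψb]
  linarith [h.energy ψ C hψ hψb s t hs hst]

lemma memLp_top_one : MemLp (fun _ : ℝ => (1 : ℝ)) ⊤ (volume : Measure ℝ) := memLp_top_const 1

/-- Conservation of the total energy. -/
lemma ConservationLaws.weightedEnergy_one {P Q : ℝ → L2} (h : ConservationLaws κ P Q)
    (hκ : MemLp κ ⊤ (volume : Measure ℝ)) {t : ℝ} (ht : 0 ≤ t) :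
    weightedEnergy κ (fun _ => 1) (P t) (Q t) = weightedEnergy κ (fun _ => 1) (P 0) (Q 0) := by
  have := h.weightedEnergy_sub hκ (LipschitzWith.const (1 : ℝ)) memLp_top_one le_rfl ht
  simp [form] at this
  linarith

/-! ### Finite speed of propagation -/

/-- A trapezoidal bump: `0` outside `[R, N]` and `1` on `[R + 1, N - 1]`. -/
def trapezoid (R N r : ℝ) : ℝ := max 0 (min 1 (min (r - R) (N - r)))

/-- The primitive of `trapezoid`: a bounded nondecreasing `C^{1,1}` function which vanishes on
`(-∞, R]` and stays within distance one of `r - R` for `R ≤ r ≤ N - 1`. -/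
def smoothRamp (R N r : ℝ) : ℝ := ∫ s in (0 : ℝ)..r, trapezoid R N s

lemma trapezoid_nonneg (R N r : ℝ) : 0 ≤ trapezoid R N r := le_max_left _ _

lemma trapezoid_le_one (R N r : ℝ) : trapezoid R N r ≤ 1 :=
  max_le zero_le_one (min_le_left _ _)

lemma trapezoid_eq_zero {R N r : ℝ} (h : r ≤ R) : trapezoid R N r = 0 :=
  max_eq_left ((min_le_right _ _).trans ((min_le_left _ _).trans (by linarith)))

lemma trapezoid_eq_zero' {R N r : ℝ} (h : N ≤ r) : trapezoid R N r = 0 :=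
  max_eq_left ((min_le_right _ _).trans ((min_le_right _ _).trans (by linarith)))

lemma trapezoid_eq_one {R N r : ℝ} (h : R + 1 ≤ r) (h' : r ≤ N - 1) : trapezoid R N r = 1 := by
  unfold trapezoid
  rw [min_eq_left (le_min (by linarith) (by linarith)), max_eq_right zero_le_one]

lemma abs_trapezoid_sub_le (R N a b : ℝ) : |trapezoid R N a - trapezoid R N b| ≤ |a - b| := by
  unfold trapezoid
  refine (abs_max_sub_max_le_max _ _ _ _).trans (max_le (by simp) ?_)
  refine (abs_min_sub_min_le_max _ _ _ _).trans (max_le (by simp) ?_)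
  refine (abs_min_sub_min_le_max _ _ _ _).trans (max_le (by simp) ?_)
  rw [abs_sub_comm]
  simp

lemma continuous_trapezoid (R N : ℝ) : Continuous (trapezoid R N) := by
  unfold trapezoid
  fun_prop

lemma hasDerivAt_smoothRamp (R N r : ℝ) : HasDerivAt (smoothRamp R N) (trapezoid R N r) r :=
  ((continuous_trapezoid R N).integral_hasStrictDerivAt 0 r).hasDerivAt

lemma smoothRamp_sub (R N a b : ℝ) :
    smoothRamp R N b - smoothRamp R N a = ∫ s in a..b, trapezoid R N s :=
  intervalIntegral.integral_interval_sub_left ((continuous_trapezoid R N).intervalIntegrable _ _)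
    ((continuous_trapezoid R N).intervalIntegrable _ _)

lemma smoothRamp_monotone (R N : ℝ) : Monotone (smoothRamp R N) := fun a b hab => by
  rw [← sub_nonneg, smoothRamp_sub]
  exact intervalIntegral.integral_nonneg hab fun s _ => trapezoid_nonneg R N s

lemma smoothRamp_sub_le (R N : ℝ) {a b : ℝ} (hab : a ≤ b) :
    smoothRamp R N b - smoothRamp R N a ≤ b - a := by
  rw [smoothRamp_sub]
  calc ∫ s in a..b, trapezoid R N s ≤ ∫ _ in a..b, (1 : ℝ) :=
        intervalIntegral.integral_mono_on hab ((continuous_trapezoid R N).intervalIntegrable _ _)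
          intervalIntegrable_const fun s _ => trapezoid_le_one R N s
    _ = b - a := by simp

lemma abs_smoothRamp_sub_le (R N a b : ℝ) :
    |smoothRamp R N a - smoothRamp R N b| ≤ |a - b| := by
  rcases le_total a b with h | h
  · rw [abs_sub_comm, abs_sub_comm a, abs_of_nonneg (sub_nonneg.2 (smoothRamp_monotone R N h)),
      abs_of_nonneg (sub_nonneg.2 h)]
    exact smoothRamp_sub_le R N h
  · rw [abs_of_nonneg (sub_nonneg.2 (smoothRamp_monotone R N h)), abs_of_nonneg (sub_nonneg.2 h)]
    exact smoothRamp_sub_le R N h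

lemma smoothRamp_zero (R N : ℝ) : smoothRamp R N 0 = 0 := by simp [smoothRamp]

lemma smoothRamp_eq_zero {R N r : ℝ} (hR : 0 ≤ R) (h : r ≤ R) : smoothRamp R N r = 0 := by
  unfold smoothRamp
  rw [intervalIntegral.integral_congr (g := fun _ => (0 : ℝ))]
  · simp
  · intro s hs
    refine trapezoid_eq_zero ?_
    have := hs.2
    exact this.trans (max_le hR h)

lemma smoothRamp_nonneg {R N : ℝ} (hR : 0 ≤ R) (r : ℝ) : 0 ≤ smoothRamp R N r := by
  rcases le_total r R with h | h
  · rw [smoothRamp_eq_zero hR h]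
  · rw [← smoothRamp_eq_zero (N := N) hR le_rfl]
    exact smoothRamp_monotone R N h

lemma smoothRamp_le {R N r : ℝ} (hr : 0 ≤ r) : smoothRamp R N r ≤ r := by
  simpa [smoothRamp_zero] using smoothRamp_sub_le R N hr

lemma smoothRamp_le_right {R N : ℝ} (hN : 0 ≤ N) (r : ℝ) : smoothRamp R N r ≤ N := by
  rcases le_total r N with h | h
  · exact (smoothRamp_monotone R N h).trans (smoothRamp_le hN)
  · have : smoothRamp R N r - smoothRamp R N N = 0 := by
      rw [smoothRamp_sub, intervalIntegral.integral_congr (g := fun _ => (0 : ℝ))]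
      · simp
      · intro s hs
        rw [uIcc_of_le h] at hs
        exact trapezoid_eq_zero' hs.1
    linarith [smoothRamp_le (R := R) (N := N) hN]

lemma sub_le_smoothRamp {R N r : ℝ} (hR : 0 ≤ R) (h : r ≤ N - 1) :
    r - R - 1 ≤ smoothRamp R N r := by
  rcases le_total r (R + 1) with h1 | h1
  · exact le_trans (by linarith) (smoothRamp_nonneg hR r)
  · have : smoothRamp R N r - smoothRamp R N (R + 1) = r - (R + 1) := by
      rw [smoothRamp_sub, intervalIntegral.integral_congr (g := fun _ => (1 : ℝ))]
      · simp
      · intro s hs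
        rw [uIcc_of_le h1] at hs
        exact trapezoid_eq_one hs.1 (hs.2.trans h)
    linarith [smoothRamp_nonneg (N := N) hR (R + 1)]

/-- A one-sided second order Taylor estimate, from the Lipschitz bound on the derivative. -/
lemma smoothRamp_sub_le_taylor (R N r : ℝ) {δ : ℝ} (hδ : 0 ≤ δ) :
    smoothRamp R N (r - δ) - smoothRamp R N r ≤ -δ * trapezoid R N r + δ ^ 2 := by
  have h1 : ∫ _ in (r - δ)..r, (trapezoid R N r - δ) ≤ ∫ s in (r - δ)..r, trapezoid R N s := by
    refine intervalIntegral.integral_mono_on (by linarith) intervalIntegrable_const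
      ((continuous_trapezoid R N).intervalIntegrable _ _) fun s hs => ?_
    have h2 := (abs_le.1 (abs_trapezoid_sub_le R N r s)).2
    rw [abs_of_nonneg (by linarith [hs.2])] at h2
    linarith [hs.1]
  rw [← smoothRamp_sub, intervalIntegral.integral_const, smul_eq_mul] at h1
  nlinarith

/-- The weight `f (|x| - s)` moving outwards with unit speed. -/
def radialShift (f : ℝ → ℝ) (s x : ℝ) : ℝ := f (|x| - s)

lemma lipschitzWith_radialShift {f : ℝ → ℝ} (hf : ∀ a b, |f a - f b| ≤ |a - b|) (s : ℝ) :
    LipschitzWith 1 (radialShift f s) := by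
  refine LipschitzWith.of_dist_le_mul fun x y => ?_
  rw [NNReal.coe_one, one_mul, Real.dist_eq, Real.dist_eq]
  refine (hf _ _).trans ?_
  rw [sub_sub_sub_cancel_right]
  exact abs_abs_sub_abs_le x y

lemma deriv_radialShift_eq_zero {f : ℝ → ℝ} {R s x : ℝ} (hs : 0 ≤ s) (hf : ∀ r, r ≤ R → f r = 0)
    (hx : |x| < R) : deriv (radialShift f s) x = 0 := by
  have : radialShift f s =ᶠ[𝓝 x] fun _ => 0 := by
    filter_upwards [(continuous_abs.tendsto x).eventually (gt_mem_nhds hx)] with y hy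
    exact hf _ (by linarith)
  rw [this.deriv_eq]
  simp

lemma memLp_radialShift {f : ℝ → ℝ} (hf : Continuous f) {C : ℝ} (hC : ∀ r, |f r| ≤ C) (s : ℝ) :
    MemLp (radialShift f s) ⊤ (volume : Measure ℝ) := by
  refine memLp_top_of_bound ?_ C (Eventually.of_forall fun x => hC _)
  have : Continuous (radialShift f s) := by unfold radialShift; fun_prop
  exact this.aestronglyMeasurable

lemma memLp_radialShift_trapezoid (R N s : ℝ) :
    MemLp (radialShift (trapezoid R N) s) ⊤ (volume : Measure ℝ) :=
  memLp_radialShift (continuous_trapezoid R N) (C := 1) (fun r => by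
    rw [abs_of_nonneg (trapezoid_nonneg R N r)]; exact trapezoid_le_one R N r) s

lemma continuous_smoothRamp (R N : ℝ) : Continuous (smoothRamp R N) :=
  continuous_iff_continuousAt.2 fun r => (hasDerivAt_smoothRamp R N r).continuousAt

lemma memLp_radialShift_smoothRamp {R N : ℝ} (hR : 0 ≤ R) (hN : 0 ≤ N) (s : ℝ) :
    MemLp (radialShift (smoothRamp R N) s) ⊤ (volume : Measure ℝ) :=
  memLp_radialShift (continuous_smoothRamp R N) (C := N) (fun r => by
    rw [abs_of_nonneg (smoothRamp_nonneg hR r)]; exact smoothRamp_le_right hN r) s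

lemma abs_deriv_radialShift_smoothRamp_le {R N s : ℝ} (hR : 0 < R) (hs : 0 ≤ s) (x : ℝ) :
    |deriv (radialShift (smoothRamp R N) s) x| ≤ radialShift (trapezoid R N) s x := by
  rcases eq_or_ne x 0 with rfl | hx
  · rw [deriv_radialShift_eq_zero hs (fun r => smoothRamp_eq_zero hR.le) (by simpa using hR),
      abs_zero]
    exact trapezoid_nonneg _ _ _
  · have h1 : HasDerivAt (radialShift (smoothRamp R N) s)
        (trapezoid R N (|x| - s) * (SignType.sign x : ℝ)) x :=
      (hasDerivAt_smoothRamp R N (|x| - s)).comp x ((hasDerivAt_abs hx).sub_const s)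
    rw [h1.deriv, abs_mul, abs_of_nonneg (trapezoid_nonneg R N _)]
    refine mul_le_of_le_one_right (trapezoid_nonneg R N _) ?_
    rcases lt_or_gt_of_ne hx with h | h <;> simp [h]

/-- A function whose increments are quadratically small from above does not increase. -/
lemma le_of_forall_sub_le_mul_sq {W : ℝ → ℝ} {C : ℝ}
    (h : ∀ s t, 0 ≤ s → s ≤ t → W t - W s ≤ C * (t - s) ^ 2) {t : ℝ} (ht : 0 ≤ t) :
    W t ≤ W 0 := by
  have key : ∀ n : ℕ, W t - W 0 ≤ C * t ^ 2 / ((n : ℝ) + 1) := fun n => by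
    set δ : ℝ := t / ((n : ℝ) + 1) with hδ
    have hn : (0 : ℝ) < (n : ℝ) + 1 := by positivity
    have hδ0 : 0 ≤ δ := by positivity
    have h1 : ∀ k : ℕ, W (k * δ) - W 0 ≤ k * (C * δ ^ 2) := fun k => by
      induction k with
      | zero => simp
      | succ k ih =>
        have := h (k * δ) ((k + 1 : ℕ) * δ) (by positivity) (by push_cast; nlinarith)
        push_cast at this ⊢
        nlinarith
    have h2 := h1 (n + 1)
    have h3 : ((n + 1 : ℕ) : ℝ) * δ = t := by
      rw [hδ]; push_cast; field_simp
    rw [h3] at h2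
    refine h2.trans (le_of_eq ?_)
    rw [hδ]; push_cast; field_simp
  have hlim : Tendsto (fun n : ℕ => C * t ^ 2 / ((n : ℝ) + 1)) atTop (𝓝 0) := by
    have := (tendsto_one_div_add_atTop_nhds_zero_nat (𝕜 := ℝ)).const_mul (C * t ^ 2)
    simpa [div_eq_mul_inv] using this
  linarith [ge_of_tendsto' hlim key]

/-- Energy outside the light cone does not increase. The moving weight is compared with frozen
ones on short time intervals; the errors are quadratic in the length of the interval. -/
theorem ConservationLaws.weightedEnergy_radialShift_le {P Q : ℝ → L2}
    (h : ConservationLaws κ P Q) (hκ : IsCoefficient κ L K η) {R N : ℝ} (hR : L < R) (hN : 0 ≤ N)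
    {t : ℝ} (ht : 0 ≤ t) :
    weightedEnergy κ (radialShift (smoothRamp R N) t) (P t) (Q t) ≤
      weightedEnergy κ (radialShift (smoothRamp R N) 0) (P 0) (Q 0) := by
  set E := weightedEnergy κ (fun _ => 1) (P 0) (Q 0) with hE
  have hR0 : 0 < R := hκ.L_pos.trans hR
  have mψ := memLp_radialShift_smoothRamp (N := N) hR0.le hN
  have mg := memLp_radialShift_trapezoid R N
  have lψ := lipschitzWith_radialShift (abs_smoothRamp_sub_le R N)
  have lg := lipschitzWith_radialShift (abs_trapezoid_sub_le R N)
  have hii : ∀ {β : ℝ → ℝ}, MemLp β ⊤ (volume : Measure ℝ) → ∀ {s t : ℝ}, 0 ≤ s → s ≤ t →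
      IntervalIntegrable (fun τ => form β (P τ) (Q τ)) volume s t := fun hβ s t hs hst =>
    ((continuousOn_form hβ h.continuousOn_fst h.continuousOn_snd).mono (by
      rw [uIcc_of_le hst]; exact fun x hx => hs.trans hx.1)).intervalIntegrable
  refine le_of_forall_sub_le_mul_sq
    (W := fun t => weightedEnergy κ (radialShift (smoothRamp R N) t) (P t) (Q t)) (C := 2 * E)
    (fun s t hs hst => ?_) ht
  have ht : 0 ≤ t := hs.trans hst
  set G : ℝ → ℝ := fun τ => weightedEnergy κ (radialShift (trapezoid R N) s) (P τ) (Q τ) with hG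
  -- The energy in the frozen annulus changes at most at rate `E`.
  have hG_le : ∀ τ ∈ Icc s t, G τ ≤ G t + (t - s) * E := fun τ hτ => by
    have h0 := hs.trans hτ.1
    have h1 := h.weightedEnergy_sub hκ.memLp (lg s) (mg s) h0 hτ.2
    have h2 : ∫ σ in τ..t, form (deriv (radialShift (trapezoid R N) s)) (P σ) (Q σ) ≤
        ∫ _ in τ..t, E := by
      refine intervalIntegral.integral_mono_on hτ.2
        (hii (memLp_deriv_of_lipschitz (lg s)) h0 hτ.2) intervalIntegrable_const fun σ hσ => ?_
      have h3 := hκ.abs_form_le_of_eq_zero memLp_top_one (memLp_deriv_of_lipschitz (lg s))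
        (fun _ => zero_le_one) (fun x => by simpa using norm_deriv_le_of_lipschitz (lg s) (x₀ := x))
        (fun x hx => deriv_radialShift_eq_zero hs (fun r => trapezoid_eq_zero)
          (hx.trans_lt hR)) (P σ) (Q σ)
      rw [h.weightedEnergy_one hκ.memLp (h0.trans hσ.1)] at h3
      exact (le_abs_self _).trans h3
    have hE0 : 0 ≤ E := hκ.weightedEnergy_nonneg (fun _ => zero_le_one) _ _
    rw [intervalIntegral.integral_const, smul_eq_mul] at h2
    have h4 : (t - τ) * E ≤ (t - s) * E := by gcongr; exact hτ.1
    simp only [hG]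
    linarith
  -- The flux through the frozen weight.
  have hflux : weightedEnergy κ (radialShift (smoothRamp R N) s) (P t) (Q t) -
      weightedEnergy κ (radialShift (smoothRamp R N) s) (P s) (Q s) ≤
      (t - s) * (G t + (t - s) * E) := by
    rw [h.weightedEnergy_sub hκ.memLp (lψ s) (mψ s) hs hst, ← intervalIntegral.integral_neg]
    refine (intervalIntegral.integral_mono_on (g := fun _ => G t + (t - s) * E) hst
      (hii (memLp_deriv_of_lipschitz (lψ s)) hs hst).neg intervalIntegrable_const
      fun τ hτ => ?_).trans (by simp [mul_add])
    have h3 := hκ.abs_form_le_of_eq_zero (mg s) (memLp_deriv_of_lipschitz (lψ s))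
      (fun x => trapezoid_nonneg _ _ _) (abs_deriv_radialShift_smoothRamp_le hR0 hs)
      (fun x hx => deriv_radialShift_eq_zero hs (fun r => smoothRamp_eq_zero hR0.le)
        (hx.trans_lt hR)) (P τ) (Q τ)
    exact ((neg_le_abs _).trans h3).trans (hG_le τ hτ)
  -- The gain from moving the weight outwards.
  have hmove : weightedEnergy κ (radialShift (smoothRamp R N) t) (P t) (Q t) ≤
      weightedEnergy κ (radialShift (smoothRamp R N) s) (P t) (Q t) +
        (-(t - s) * G t + (t - s) ^ 2 * E) := by
    have m1 := (mg s).const_mul (-(t - s))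
    have m2 := memLp_top_one.const_mul ((t - s) ^ 2)
    have h1 := hκ.weightedEnergy_mono (mψ t) ((mψ s).add (m1.add m2)) (fun x => ?_) (P t) (Q t)
    · refine h1.trans (le_of_eq ?_)
      refine (weightedEnergy_add hκ.memLp (mψ s) (m1.add m2) _ _).trans ?_
      congr 1
      refine (weightedEnergy_add hκ.memLp m1 m2 _ _).trans ?_
      rw [weightedEnergy_const_mul, weightedEnergy_const_mul, h.weightedEnergy_one hκ.memLp ht]
    · have := smoothRamp_sub_le_taylor R N (|x| - s) (sub_nonneg.2 hst)
      rw [show |x| - s - (t - s) = |x| - t by ring] at this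
      simp only [Pi.add_apply, radialShift]
      linarith
  nlinarith

end

/-! ### The integral inequality for the local energy -/

lemma lipschitzWith_mul_of_bounded {f g : ℝ → ℝ} {Kf Kg A B : NNReal} (hf : LipschitzWith Kf f)
    (hg : LipschitzWith Kg g) (hA : ∀ x, |f x| ≤ A) (hB : ∀ x, |g x| ≤ B) :
    LipschitzWith (A * Kg + Kf * B) (f * g) := by
  refine LipschitzWith.of_dist_le_mul fun x y => ?_
  have h1 := hf.dist_le_mul x y
  have h2 := hg.dist_le_mul x y
  rw [Real.dist_eq] at *
  simp only [Pi.mul_apply]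
  push_cast
  calc |f x * g x - f y * g y| = |f x * (g x - g y) + (f x - f y) * g y| := by ring_nf
    _ ≤ |f x| * |g x - g y| + |f x - f y| * |g y| := by
      rw [← abs_mul, ← abs_mul]; exact abs_add_le _ _
    _ ≤ A * (Kg * dist x y) + (Kf * dist x y) * B := by
      gcongr
      · exact hA x
      · exact hB y
    _ = (A * Kg + Kf * B) * |x - y| := by rw [Real.dist_eq]; ring

/-- The identity truncated to `[-M, M]`. -/
def clamp (M x : ℝ) : ℝ := max (-M) (min x M)

lemma lipschitzWith_clamp (M : ℝ) : LipschitzWith 1 (clamp M) :=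
  (LipschitzWith.id.min_const M).const_max (-M)

lemma abs_clamp_le {M : ℝ} (hM : 0 ≤ M) (x : ℝ) : |clamp M x| ≤ M :=
  abs_le.2 ⟨le_max_left _ _, max_le (by linarith) (min_le_right _ _)⟩

lemma abs_clamp_le_abs {M : ℝ} (hM : 0 ≤ M) (x : ℝ) : |clamp M x| ≤ |x| := by
  refine abs_le.2 ⟨le_max_of_le_right (le_min (neg_abs_le x) (by linarith [abs_nonneg x])),
    max_le (by linarith [abs_nonneg x]) ((min_le_left _ _).trans (le_abs_self x))⟩

lemma clamp_eventuallyEq {M x : ℝ} (hx : |x| < M) : clamp M =ᶠ[𝓝 x] id := by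
  filter_upwards [(continuous_abs.tendsto x).eventually (gt_mem_nhds hx)] with y hy
  have := abs_lt.1 hy
  unfold clamp
  rw [min_eq_left this.2.le, max_eq_right this.1.le, id]

lemma deriv_clamp_eq_one {M x : ℝ} (hx : |x| < M) : deriv (clamp M) x = 1 := by
  rw [(clamp_eventuallyEq hx).deriv_eq, deriv_id]

lemma deriv_clamp_eq_zero {M x : ℝ} (hM : 0 ≤ M) (hx : M < |x|) : deriv (clamp M) x = 0 := by
  rcases lt_abs.1 hx with h | h
  · have : clamp M =ᶠ[𝓝 x] fun _ => M := by
      filter_upwards [lt_mem_nhds h] with y hy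
      unfold clamp
      rw [min_eq_right hy.le, max_eq_right (by linarith)]
    rw [this.deriv_eq, deriv_const]
  · have : clamp M =ᶠ[𝓝 x] fun _ => -M := by
      filter_upwards [gt_mem_nhds (show x < -M by linarith)] with y hy
      unfold clamp
      rw [min_eq_left (by linarith), max_eq_left hy.le]
    rw [this.deriv_eq, deriv_const]

lemma ae_abs_ne (M : ℝ) : ∀ᵐ x : ℝ, |x| ≠ M := by
  have h1 : ∀ᵐ x : ℝ, x ≠ M := by simp [ae_iff]
  have h2 : ∀ᵐ x : ℝ, x ≠ -M := by simp [ae_iff]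
  filter_upwards [h1, h2] with x hx hx' h
  rcases abs_choice x with h3 | h3
  · exact hx (h3 ▸ h)
  · exact hx' (by linarith)

/-- The indicator function of `[-R, R]`. -/
def ballWeight (R : ℝ) : ℝ → ℝ := {x : ℝ | |x| ≤ R}.indicator fun _ => 1

lemma ballWeight_of_le {R x : ℝ} (h : |x| ≤ R) : ballWeight R x = 1 :=
  indicator_of_mem (s := {x : ℝ | |x| ≤ R}) h _

lemma ballWeight_of_lt {R x : ℝ} (h : R < |x|) : ballWeight R x = 0 :=
  indicator_of_notMem (s := {x : ℝ | |x| ≤ R}) (not_le.2 h) _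

lemma ballWeight_nonneg (R x : ℝ) : 0 ≤ ballWeight R x :=
  indicator_nonneg (fun _ _ => zero_le_one) x

lemma measurableSet_abs_le (R : ℝ) : MeasurableSet {x : ℝ | |x| ≤ R} :=
  measurableSet_le measurable_abs measurable_const

lemma memLp_ballWeight (R : ℝ) : MemLp (ballWeight R) ⊤ (volume : Measure ℝ) :=
  memLp_top_one.indicator (measurableSet_abs_le R)

section

variable {κ : ℝ → ℝ} {L K η : ℝ}

lemma IsCoefficient.sqrt_le (hκ : IsCoefficient κ L K η) (x : ℝ) : √(κ x) ≤ K :=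
  Real.sqrt_le_iff.2 ⟨hκ.K_nonneg, hκ.le x⟩

lemma IsCoefficient.deriv_eq_zero (hκ : IsCoefficient κ L K η) {x : ℝ} (hx : L < |x|) :
    deriv κ x = 0 := by
  have : κ =ᶠ[𝓝 x] fun _ => 1 := by
    filter_upwards [(continuous_abs.tendsto x).eventually (lt_mem_nhds hx)] with y hy
    exact hκ.eq_one y hy
  rw [this.deriv_eq, deriv_const]

lemma IsCoefficient.lipschitz_mul_clamp (hκ : IsCoefficient κ L K η) {M : ℝ} (hM : 0 ≤ M) :
    ∃ C : NNReal, LipschitzWith C (clamp M * κ) := by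
  obtain ⟨C, hC⟩ := hκ.lipschitz
  exact ⟨_, lipschitzWith_mul_of_bounded (A := ⟨M, hM⟩) (B := ⟨K ^ 2, sq_nonneg K⟩)
    (lipschitzWith_clamp M) hC (abs_clamp_le hM) fun x => by
      rw [abs_of_pos (hκ.pos x)]; exact hκ.le x⟩

lemma memLp_clamp {M : ℝ} (hM : 0 ≤ M) : MemLp (clamp M) ⊤ (volume : Measure ℝ) :=
  memLp_top_of_bound (lipschitzWith_clamp M).continuous.aestronglyMeasurable M
    (Eventually.of_forall fun x => abs_clamp_le hM x)

/-- Pointwise bound for the production term of the truncated virial identity: up to the variation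
of `κ` on `[-L, L]` and to the tail `|x| > M`, it is minus the energy density. -/
lemma IsCoefficient.virial_density_le (hκ : IsCoefficient κ L K η) {M R : ℝ} (hR : L < R)
    (hM : R ≤ M) {ρ : ℝ → ℝ} (hρ : ∀ x, 0 ≤ ρ x) (hρ' : ∀ x, M ≤ |x| → 1 ≤ ρ x) (f g : ℝ → ℝ) :
    ∀ᵐ x, -(1 / 2) * (deriv (clamp M) x * (g x * g x) +
        deriv (clamp M * κ) x * (f x * f x)) ≤
      (-1 + (ρ x + η * ballWeight R x)) * energyDensity κ f g x := by
  have hM0 : 0 ≤ M := hκ.L_pos.le.trans (hR.le.trans hM)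
  obtain ⟨C, hC⟩ := hκ.lipschitz
  filter_upwards [hκ.deriv_le, ae_abs_ne M, hC.ae_differentiableAt_real,
    (lipschitzWith_clamp M).ae_differentiableAt_real] with x h1 h2 h3 h4
  have hd : deriv (clamp M * κ) x = deriv (clamp M) x * κ x + clamp M x * deriv κ x :=
    (h4.hasDerivAt.mul h3.hasDerivAt).deriv
  have he := hκ.energyDensity_nonneg f g x
  have hκx := (hκ.pos x).le
  have hη : 0 ≤ η := by
    have : 0 ≤ η * κ x := (mul_nonneg hκ.L_pos.le (abs_nonneg _)).trans h1
    exact nonneg_of_mul_nonneg_left this (hκ.pos x)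
  rw [hd]
  -- The contribution of `κ'` is supported in `[-L, L]`.
  have hvar : -(1 / 2) * (clamp M x * deriv κ x * (f x * f x)) ≤
      η * ballWeight R x * energyDensity κ f g x := by
    rcases le_or_gt |x| L with hx | hx
    · rw [ballWeight_of_le (hx.trans hR.le), mul_one]
      have h5 : -(clamp M x * deriv κ x) ≤ η * κ x := by
        refine (neg_le_abs _).trans (le_trans ?_ h1)
        rw [abs_mul]
        gcongr
        exact (abs_clamp_le_abs hM0 x).trans hx
      have h6 := mul_le_mul_of_nonneg_right h5 (mul_self_nonneg (f x))
      have h7 : η * κ x * (f x * f x) ≤ 2 * (η * energyDensity κ f g x) := by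
        unfold energyDensity
        have := mul_nonneg hη (sq_nonneg (g x))
        nlinarith
      linarith
    · rw [hκ.deriv_eq_zero hx]
      have := mul_nonneg (mul_nonneg hη (ballWeight_nonneg R x)) he
      simpa using this
  have hmain : -deriv (clamp M) x * energyDensity κ f g x ≤
      (-1 + ρ x) * energyDensity κ f g x := by
    refine mul_le_mul_of_nonneg_right ?_ he
    rcases lt_or_gt_of_ne h2 with hx | hx
    · rw [deriv_clamp_eq_one hx]
      linarith [hρ x]
    · rw [deriv_clamp_eq_zero hM0 hx]
      linarith [hρ' x hx.le]
  have e1 : -(1 / 2) * (deriv (clamp M) x * (g x * g x) +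
      (deriv (clamp M) x * κ x + clamp M x * deriv κ x) * (f x * f x)) =
      -deriv (clamp M) x * energyDensity κ f g x +
        -(1 / 2) * (clamp M x * deriv κ x * (f x * f x)) := by
    unfold energyDensity
    ring
  rw [e1]
  linarith

/-- The integral inequality `(t - K R) E_R(t) ≤ C + η ∫₀ᵗ E_R` for the local energy. -/
theorem ConservationLaws.exists_localEnergy_le {P Q : ℝ → L2}
    (h : ConservationLaws κ P Q) (hκ : IsCoefficient κ L K η) {R : ℝ} (hR : L < R)
    (hD : Integrable fun x => |x| * energyDensity κ (P 0) (Q 0) x) :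
    ∃ C, 0 ≤ C ∧ ∀ t, 1 ≤ t →
      (t - K * R) * weightedEnergy κ (ballWeight R) (P t) (Q t) ≤
        C + η * ∫ τ in (0 : ℝ)..t, weightedEnergy κ (ballWeight R) (P τ) (Q τ) := by
  have hR0 : 0 < R := hκ.L_pos.trans hR
  set E := weightedEnergy κ (fun _ => 1) (P 0) (Q 0) with hE
  set D := ∫ x, |x| * energyDensity κ (P 0) (Q 0) x with hDdef
  have hE0 : 0 ≤ E := hκ.weightedEnergy_nonneg (fun _ => zero_le_one) _ _
  have hD0 : 0 ≤ D := integral_nonneg fun x =>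
    mul_nonneg (abs_nonneg x) (hκ.energyDensity_nonneg _ _ x)
  have hK0 := hκ.K_nonneg
  refine ⟨K * D + 2 * D + (R + 1) * E, by positivity, fun t ht => ?_⟩
  have ht0 : 0 < t := by linarith
  -- Truncation at `M` is far enough outside the light cone for the tail to be of order `D / t`.
  set M : ℝ := 2 * t + R + 1 with hM
  have hM0 : 0 ≤ M := by positivity
  have hRM : R ≤ M := by linarith
  obtain ⟨Cχ, hCχ⟩ := hκ.lipschitz_mul_clamp hM0
  have mχ := memLp_clamp hM0
  have mχκ : MemLp (clamp M * κ) ⊤ (volume : Measure ℝ) := hκ.memLp.mul mχ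
  set S : ℝ → ℝ → ℝ := radialShift (smoothRamp R M) with hS
  have mS : ∀ s, MemLp (S s) ⊤ (volume : Measure ℝ) :=
    memLp_radialShift_smoothRamp hR0.le hM0
  have hS0 : ∀ s x, 0 ≤ S s x := fun s x => smoothRamp_nonneg hR0.le _
  have mB := memLp_ballWeight R
  -- Energy outside the cone.
  have hcone : ∀ τ, 0 ≤ τ → weightedEnergy κ (S τ) (P τ) (Q τ) ≤ D := fun τ hτ => by
    refine (h.weightedEnergy_radialShift_le hκ hR hM0 hτ).trans ?_
    refine integral_mono (integrable_weightedEnergy hκ.memLp (mS 0) _ _) hD fun x => ?_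
    refine mul_le_mul_of_nonneg_right ?_ (hκ.energyDensity_nonneg _ _ x)
    simp only [radialShift, sub_zero]
    exact smoothRamp_le (abs_nonneg x)
  -- The truncated virial identity.
  have hvir := h.momentum (clamp M) 1 Cχ (lipschitzWith_clamp M) hCχ mχ mχκ 0 t le_rfl ht0.le
  have d1 := memLp_deriv_of_lipschitz (lipschitzWith_clamp M)
  have d2 := memLp_deriv_of_lipschitz hCχ
  have hsub : uIcc 0 t ⊆ Ici (0 : ℝ) := by
    rw [uIcc_of_le ht0.le]
    exact Icc_subset_Ici_self
  have hEint : IntervalIntegrable (fun τ => weightedEnergy κ (ballWeight R) (P τ) (Q τ))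
      volume 0 t := ((continuousOn_weightedEnergy hκ.memLp mB h.continuousOn_fst
        h.continuousOn_snd).mono hsub).intervalIntegrable
  have hprod : -(1 / 2) * ∫ τ in (0 : ℝ)..t, (form (deriv (clamp M)) (Q τ) (Q τ) +
      form (deriv (clamp M * κ)) (P τ) (P τ)) ≤
      -(t * E) + D + η * ∫ τ in (0 : ℝ)..t, weightedEnergy κ (ballWeight R) (P τ) (Q τ) := by
    have e1 : -(t * E) + D + η * ∫ τ in (0 : ℝ)..t, weightedEnergy κ (ballWeight R) (P τ) (Q τ) =
        ∫ τ in (0 : ℝ)..t, ((-E + D / t) +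
          η * weightedEnergy κ (ballWeight R) (P τ) (Q τ)) := by
      rw [intervalIntegral.integral_add intervalIntegrable_const (hEint.const_mul η),
        intervalIntegral.integral_const, intervalIntegral.integral_const_mul, smul_eq_mul]
      field_simp
      ring
    rw [e1, ← intervalIntegral.integral_const_mul]
    have c1 := (((continuousOn_form d1 h.continuousOn_snd h.continuousOn_snd).add
      (continuousOn_form d2 h.continuousOn_fst h.continuousOn_fst)).mono hsub).intervalIntegrable
      (μ := volume)
    refine intervalIntegral.integral_mono_on ht0.le (c1.const_mul _)
      (intervalIntegrable_const.add (hEint.const_mul η)) fun τ hτ => ?_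
    have m1 := (mS τ).const_mul (1 / t)
    have m2 := mB.const_mul η
    have m3 := memLp_top_one.const_mul (-1)
    have hpt := hκ.virial_density_le hR hRM (ρ := fun x => 1 / t * S τ x)
      (fun x => mul_nonneg (by positivity) (hS0 τ x)) (fun x hx => ?_) (P τ) (Q τ)
    · have i1 := integrable_form d1 (Q τ) (Q τ)
      have i2 := integrable_form d2 (P τ) (P τ)
      rw [form, form, ← integral_add i1 i2, ← integral_const_mul]
      have i3 := integrable_weightedEnergy hκ.memLp (m3.add (m1.add m2)) (P τ) (Q τ)
      have h1 := integral_mono_ae ((i1.add i2).const_mul (-(1 / 2))) i3 (by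
        filter_upwards [hpt] with x hx
        simpa using hx)
      refine h1.trans ?_
      have e2 := weightedEnergy_add hκ.memLp m3 (m1.add m2) (P τ) (Q τ)
      have e3 := weightedEnergy_add hκ.memLp m1 m2 (P τ) (Q τ)
      rw [weightedEnergy_const_mul, weightedEnergy_const_mul] at e3
      rw [weightedEnergy_const_mul, h.weightedEnergy_one hκ.memLp hτ.1] at e2
      have e4 : 1 / t * weightedEnergy κ (S τ) (P τ) (Q τ) ≤ D / t := by
        rw [one_div_mul_eq_div]
        gcongr
        exact hcone τ hτ.1
      refine e2.le.trans ?_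
      refine (add_le_add_right e3.le _).trans ?_
      linarith
    · have h1 : t ≤ S τ x := by
        have h2 := sub_le_smoothRamp (R := R) (N := M) (r := M - t) hR0.le (by linarith)
        have h3 : smoothRamp R M (M - t) ≤ S τ x :=
          smoothRamp_monotone R M (by linarith [hτ.2])
        linarith
      rw [one_div_mul_eq_div]
      exact (one_le_div ht0).2 h1
  -- The virial quantity at both ends of the time interval.
  have mσ : MemLp (fun x => |clamp M x| * √(κ x)) ⊤ (volume : Measure ℝ) := by
    obtain ⟨C, hC⟩ := hκ.lipschitz
    have h1 := hC.continuous
    have h2 := (lipschitzWith_clamp M).continuous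
    refine memLp_top_of_bound (by fun_prop) (M * K) (Eventually.of_forall fun x => ?_)
    rw [Real.norm_of_nonneg (by positivity)]
    exact mul_le_mul (abs_clamp_le hM0 x) (hκ.sqrt_le x) (Real.sqrt_nonneg _) hM0
  have hform : ∀ τ, |form (clamp M * κ) (P τ) (Q τ)| ≤
      weightedEnergy κ (fun x => |clamp M x| * √(κ x)) (P τ) (Q τ) := fun τ =>
    hκ.abs_form_le mσ mχκ (fun x => by
      rw [Pi.mul_apply, abs_mul, abs_of_pos (hκ.pos x), mul_assoc,
        Real.mul_self_sqrt (hκ.pos x).le]) _ _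
  have hinit : weightedEnergy κ (fun x => |clamp M x| * √(κ x)) (P 0) (Q 0) ≤ K * D := by
    rw [hDdef, ← integral_const_mul]
    refine integral_mono (integrable_weightedEnergy hκ.memLp mσ _ _) (hD.const_mul K) fun x => ?_
    simp only
    rw [← mul_assoc]
    refine mul_le_mul_of_nonneg_right ?_ (hκ.energyDensity_nonneg _ _ x)
    rw [mul_comm K]
    exact mul_le_mul (abs_clamp_le_abs hM0 x) (hκ.sqrt_le x) (Real.sqrt_nonneg _) (abs_nonneg x)
  have hfinal : (t - K * R) * weightedEnergy κ (ballWeight R) (P t) (Q t) ≤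
      (t + R + 1) * E + (weightedEnergy κ (S t) (P t) (Q t) +
        -1 * weightedEnergy κ (fun x => |clamp M x| * √(κ x)) (P t) (Q t)) := by
    have m1 := memLp_top_one.const_mul (t + R + 1)
    have m2 := mσ.const_mul (-1)
    have m3 := (mS t).add m2
    have e1 := weightedEnergy_add hκ.memLp m1 m3 (P t) (Q t)
    have e2 := weightedEnergy_add hκ.memLp (mS t) m2 (P t) (Q t)
    rw [weightedEnergy_const_mul] at e2
    rw [weightedEnergy_const_mul, h.weightedEnergy_one hκ.memLp ht0.le] at e1
    rw [← e2, ← weightedEnergy_const_mul]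
    refine (hκ.weightedEnergy_mono (mB.const_mul (t - K * R)) (m1.add m3) (fun x => ?_) _ _).trans
      e1.le
    simp only [Pi.add_apply]
    have hSx := hS0 t x
    rcases le_or_gt |x| R with hx | hx
    · rw [ballWeight_of_le hx]
      have : |clamp M x| * √(κ x) ≤ R * K :=
        mul_le_mul ((abs_clamp_le_abs hM0 x).trans hx) (hκ.sqrt_le x) (Real.sqrt_nonneg _) hR0.le
      linarith
    · rw [ballWeight_of_lt hx, hκ.eq_one x (hR.trans hx), Real.sqrt_one]
      have h1 : |clamp M x| ≤ t + R + 1 + S t x := by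
        rcases le_total (|x| - t) (M - 1) with h2 | h2
        · have h3 : |x| - t - R - 1 ≤ S t x := sub_le_smoothRamp hR0.le h2
          linarith [abs_clamp_le_abs hM0 x]
        · have h3 := sub_le_smoothRamp (R := R) (N := M) hR0.le le_rfl
          have h4 : smoothRamp R M (M - 1) ≤ S t x := smoothRamp_monotone R M h2
          linarith [abs_clamp_le hM0 x]
      linarith
  have h1 := hform t
  have h2 := hform 0
  have h3 := hcone t ht0.le
  have h4 := neg_abs_le (form (clamp M * κ) (P t) (Q t))
  have h5 := le_abs_self (form (clamp M * κ) (P 0) (Q 0))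
  linarith

end

/-! ### Polynomial decay from the integral inequality -/

/-- A Grönwall argument: `(t - a) f ≤ C + η ∫₀ᵗ f` forces `f = O(t ^ (η - 1))`, because
`(C + η ∫₀ᵗ f) (t - a) ^ (-η)` is nonincreasing. -/
lemma isBigO_rpow_of_sub_mul_le {f : ℝ → ℝ} {a C η : ℝ} (hf : ContinuousOn f (Ici 0))
    (hf0 : ∀ t, 0 ≤ t → 0 ≤ f t) (ha : 0 ≤ a) (hC : 0 ≤ C) (hη : 0 ≤ η) (hη1 : η < 1)
    (h : ∀ t, 1 ≤ t → (t - a) * f t ≤ C + η * ∫ τ in (0 : ℝ)..t, f τ) :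
    f =O[atTop] fun t => t ^ (-(1 - η)) := by
  set G : ℝ → ℝ := fun t => C + η * ∫ τ in (0 : ℝ)..t, f τ with hG
  have hG0 : ∀ t, 0 ≤ t → 0 ≤ G t := fun t ht => by
    have := intervalIntegral.integral_nonneg ht (f := f) (μ := volume) fun s hs => hf0 s hs.1
    positivity
  have hGd : ∀ t, 0 < t → HasDerivAt G (η * f t) t := fun t ht => by
    have h1 : IntervalIntegrable f volume 0 t := by
      refine (hf.mono ?_).intervalIntegrable
      rw [uIcc_of_le ht.le]
      exact Icc_subset_Ici_self
    have h2 := intervalIntegral.integral_hasDerivAt_right h1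
      ((hf.mono Ioi_subset_Ici_self).stronglyMeasurableAtFilter isOpen_Ioi t ht)
      (hf.continuousAt (Ici_mem_nhds ht))
    exact (h2.const_mul η).const_add C
  set H : ℝ → ℝ := fun t => G t * (t - a) ^ (-η) with hH
  have hHd : ∀ t, a < t → 0 < t → HasDerivAt H
      (η * f t * (t - a) ^ (-η) + G t * (1 * -η * (t - a) ^ (-η - 1))) t := fun t hat ht =>
    (hGd t ht).mul (((hasDerivAt_id t).sub_const a).rpow_const (Or.inl (sub_pos.2 hat).ne'))
  have hanti : AntitoneOn H (Ici (a + 1)) := by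
    refine antitoneOn_of_deriv_nonpos (convex_Ici _)
      (fun t ht => (hHd t (by linarith [mem_Ici.1 ht])
        (by linarith [mem_Ici.1 ht])).continuousAt.continuousWithinAt) (fun t ht => ?_)
      fun t ht => ?_
    all_goals rw [interior_Ici, mem_Ioi] at ht
    · exact (hHd t (by linarith) (by linarith)).differentiableAt.differentiableWithinAt
    · rw [(hHd t (by linarith) (by linarith)).deriv]
      have hpos : 0 < t - a := by linarith
      have e1 : (t - a) ^ (-η) = (t - a) ^ (-η - 1) * (t - a) := by
        rw [← Real.rpow_add_one hpos.ne']
        ring_nf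
      have h1 := mul_le_mul_of_nonneg_left (h t (by linarith))
        (mul_nonneg hη (Real.rpow_nonneg hpos.le (-η - 1)))
      rw [e1]
      simp only [hG] at h1 ⊢
      nlinarith
  set B := H (a + 1) with hB
  have hB0 : 0 ≤ B := mul_nonneg (hG0 _ (by linarith)) (Real.rpow_nonneg (by linarith) _)
  refine IsBigO.of_bound (B * (1 / 2) ^ (-(1 - η))) ?_
  filter_upwards [eventually_ge_atTop (2 * a + 2)] with t ht
  have ht0 : 0 < t := by linarith
  have hpos : 0 < t - a := by linarith
  have h1 : H t ≤ B := hanti (mem_Ici.2 le_rfl) (mem_Ici.2 (by linarith)) (by linarith)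
  have h2 : G t ≤ B * (t - a) ^ η := by
    have := mul_le_mul_of_nonneg_right h1 (Real.rpow_nonneg hpos.le η)
    simp only [hH] at this
    rwa [mul_assoc, ← Real.rpow_add hpos, neg_add_cancel, Real.rpow_zero, mul_one] at this
  have h3 : f t ≤ B * (t - a) ^ (-(1 - η)) := by
    have e1 : (t - a) ^ η = (t - a) ^ (-(1 - η)) * (t - a) := by
      rw [← Real.rpow_add_one hpos.ne']
      ring_nf
    have h4 := (h t (by linarith)).trans h2
    rw [e1, ← mul_assoc, mul_comm] at h4
    exact le_of_mul_le_mul_right h4 hpos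
  rw [Real.norm_of_nonneg (hf0 t ht0.le), Real.norm_of_nonneg (Real.rpow_nonneg ht0.le _),
    mul_assoc, ← Real.mul_rpow (by norm_num) ht0.le]
  refine h3.trans (mul_le_mul_of_nonneg_left ?_ hB0)
  exact Real.rpow_le_rpow_of_nonpos (by linarith) (by linarith) (by linarith)

/-! ### The coefficient of the wave equation -/

lemma ae_abs_le_linftyNorm {f : ℝ → ℝ} (hf : MemLp f ⊤ (volume : Measure ℝ)) :
    ∀ᵐ x, |f x| ≤ linftyNorm f := by
  filter_upwards [ae_le_eLpNormEssSup (f := f) (μ := volume)] with x hx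
  rw [← eLpNorm_exponent_top] at hx
  have := ENNReal.toReal_mono hf.2.ne hx
  simpa [linftyNorm] using this

lemma forall_of_ae_of_isClosed {p : ℝ → Prop} (h : ∀ᵐ x, p x) (hc : IsClosed {x | p x}) (x : ℝ) :
    p x := by
  have h1 := (Measure.dense_of_ae h).closure_eq
  rw [hc.closure_eq] at h1
  exact h1.ge (mem_univ x)

/-- The continuous representative of `c⁻²` is an admissible coefficient. -/
theorem AssumptionA1.exists_isCoefficient {c dc : ℝ → ℝ} {L : ℝ} (h1 : AssumptionA1 c dc)
    (h2 : AssumptionA2 c L) :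
    ∃ κ : ℝ → ℝ, IsCoefficient κ L (linftyNorm fun x => (c x)⁻¹) (eta c dc L) ∧
      ∀ᵐ x, κ x = 1 / c x ^ 2 := by
  obtain ⟨C, hC⟩ := h1.weakDeriv.exists_primitive
  set K := linftyNorm fun x => (c x)⁻¹ with hK
  set m := linftyNorm dc with hm
  have hK0 : 0 ≤ K := ENNReal.toReal_nonneg
  have hm0 : 0 ≤ m := ENNReal.toReal_nonneg
  set b : ℝ → ℝ := fun x => C + ∫ t in (0 : ℝ)..x, dc t with hb
  have hbl : LipschitzWith ⟨m, hm0⟩ b := by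
    refine LipschitzWith.of_dist_le_mul fun x y => ?_
    have hi : ∀ a b, IntervalIntegrable dc volume a b := fun a b =>
      (h1.weakDeriv.locInt_deriv.integrableOn_isCompact isCompact_uIcc).intervalIntegrable
    rw [Real.dist_eq, Real.dist_eq, hb]
    simp only [add_sub_add_left_eq_sub]
    rw [intervalIntegral.integral_interval_sub_left (hi _ _) (hi _ _)]
    rw [← Real.norm_eq_abs]
    refine intervalIntegral.norm_integral_le_of_norm_le_const_ae (C := m) ?_
    filter_upwards [ae_abs_le_linftyNorm h1.memLp_deriv] with z hz _
    exact hz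
  have hbc := hbl.continuous
  have hbK : ∀ x, 1 ≤ K * b x := forall_of_ae_of_isClosed (by
    filter_upwards [hC, ae_abs_le_linftyNorm h1.memLp_inv] with x hx hx'
    rw [abs_of_pos (inv_pos.2 (h1.pos x))] at hx'
    change 1 ≤ K * (C + ∫ t in (0 : ℝ)..x, dc t)
    rw [← hx]
    exact (inv_le_iff_one_le_mul₀ (h1.pos x)).1 hx')
    (isClosed_le continuous_const (continuous_const.mul hbc))
  have hb1 : ∀ x, |x| ≤ L ∨ b x = 1 := forall_of_ae_of_isClosed (by
    filter_upwards [hC] with x hx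
    rcases le_or_gt |x| L with h | h
    · exact Or.inl h
    · exact Or.inr (hx.symm.trans (h2.eq_one x h)))
    ((isClosed_le continuous_abs continuous_const).union (isClosed_eq hbc continuous_const))
  have hb0 : ∀ x, 0 < b x := fun x => by
    by_contra hx
    have := mul_nonpos_of_nonneg_of_nonpos hK0 (not_lt.1 hx)
    linarith [hbK x]
  have hbi : ∀ x, (b x)⁻¹ ≤ K := fun x => (inv_le_iff_one_le_mul₀ (hb0 x)).2 (hbK x)
  have hbi0 : ∀ x, 0 ≤ (b x)⁻¹ := fun x => (inv_pos.2 (hb0 x)).le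
  have hil : LipschitzWith (⟨K, hK0⟩ * ⟨K, hK0⟩ * ⟨m, hm0⟩) fun x => (b x)⁻¹ := by
    refine LipschitzWith.of_dist_le_mul fun x y => ?_
    have h3 := hbl.dist_le_mul y x
    rw [Real.dist_eq] at h3 ⊢
    rw [inv_sub_inv (hb0 x).ne' (hb0 y).ne', div_eq_mul_inv, mul_inv, abs_mul, abs_mul,
      abs_of_nonneg (hbi0 x), abs_of_nonneg (hbi0 y), dist_comm x y]
    calc |b y - b x| * ((b x)⁻¹ * (b y)⁻¹) ≤ (m * dist y x) * (K * K) := by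
          exact mul_le_mul h3 (mul_le_mul (hbi x) (hbi y) (hbi0 y) hK0)
            (mul_nonneg (hbi0 x) (hbi0 y)) (mul_nonneg hm0 dist_nonneg)
      _ = K * K * m * dist y x := by ring
  have habs : ∀ x, |(b x)⁻¹| ≤ K := fun x => by rw [abs_of_nonneg (hbi0 x)]; exact hbi x
  refine ⟨(fun x => (b x)⁻¹) * fun x => (b x)⁻¹, ⟨h2.pos, hK0, fun x => ?_, fun x => ?_,
    ⟨_, lipschitzWith_mul_of_bounded (A := ⟨K, hK0⟩) (B := ⟨K, hK0⟩) hil hil habs habs⟩,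
    fun x hx => ?_, ?_⟩, ?_⟩
  · exact mul_pos (inv_pos.2 (hb0 x)) (inv_pos.2 (hb0 x))
  · rw [sq]
    exact mul_le_mul (hbi x) (hbi x) (hbi0 x) hK0
  · simp [(hb1 x).resolve_left (not_le.2 hx)]
  · filter_upwards [hbl.ae_differentiableAt_real] with x hx
    have h3 := hx.hasDerivAt.inv (hb0 x).ne'
    have h4 : HasDerivAt ((fun x => (b x)⁻¹) * fun x => (b x)⁻¹)
        (-2 * deriv b x * (b x)⁻¹ * ((b x)⁻¹ * (b x)⁻¹)) x := by
      refine (h3.mul h3).congr_deriv ?_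
      have := (hb0 x).ne'
      simp only [Pi.inv_apply]
      field_simp
      ring
    have h5 : |deriv b x| ≤ m := norm_deriv_le_of_lipschitz hbl
    rw [h4.deriv, abs_mul, abs_mul, abs_mul, abs_of_nonneg (hbi0 x),
      abs_of_nonneg (mul_nonneg (hbi0 x) (hbi0 x)), eta, ← hK, ← hm, Pi.mul_apply, ← mul_assoc]
    refine mul_le_mul_of_nonneg_right ?_ (mul_nonneg (hbi0 x) (hbi0 x))
    have h6 : |deriv b x| * (b x)⁻¹ ≤ m * K := mul_le_mul h5 (hbi x) (hbi0 x) hm0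
    have h7 := mul_le_mul_of_nonneg_left h6 h2.pos.le
    norm_num
    linarith
  · filter_upwards [hC] with x hx
    rw [hx, Pi.mul_apply, one_div, sq, mul_inv]

lemma HasWeakDeriv.ae_eq {f g₁ g₂ : ℝ → ℝ} (h₁ : HasWeakDeriv f g₁) (h₂ : HasWeakDeriv f g₂) :
    g₁ =ᵐ[volume] g₂ := by
  refine ae_eq_of_integral_contDiff_smul_eq h₁.locInt_deriv h₂.locInt_deriv fun φ hφ hc => ?_
  have e1 := h₁.integral_eq φ hφ hc
  rw [h₂.integral_eq φ hφ hc, neg_inj] at e1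
  simpa [mul_comm] using e1.symm

lemma localEnergy_eq_weightedEnergy {c κ : ℝ → ℝ} (hκc : ∀ᵐ x, κ x = 1 / c x ^ 2)
    (ux ut : ℝ → L2) (R t : ℝ) :
    localEnergy c ux ut R t = weightedEnergy κ (ballWeight R) (ut t) (ux t) := by
  rw [localEnergy, ← integral_const_mul, ← integral_indicator (measurableSet_abs_le R),
    weightedEnergy]
  refine integral_congr_ae ?_
  filter_upwards [hκc] with x hx
  rcases le_or_gt |x| R with h | h
  · rw [indicator_of_mem (s := {x : ℝ | |x| ≤ R}) h, ballWeight_of_le h, energyDensity, hx,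
      sq_abs, sq_abs]
    ring
  · rw [indicator_of_notMem (s := {x : ℝ | |x| ≤ R}) (not_le.2 h), ballWeight_of_lt h, zero_mul]

end LocalEnergyDecay

end

theorem theorem1p4
    (c dc : ℝ → ℝ) (L : ℝ)
    (hA1 : LocalEnergyDecay.AssumptionA1 c dc)
    (hA2 : LocalEnergyDecay.AssumptionA2 c L)
    (hη : LocalEnergyDecay.eta c dc L < 1)
    (u₀ du₀ u₁ : LocalEnergyDecay.L2)
    (hu₀ : LocalEnergyDecay.HasWeakDeriv u₀ du₀)
    (hweight : Integrable
      (fun x : ℝ => (1 + |x|) * (1 / c x ^ 2 * |u₁ x| ^ 2 + |du₀ x| ^ 2)) volume)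
    (u ux ut : ℝ → LocalEnergyDecay.L2)
    (hu : LocalEnergyDecay.IsWeakSolution c u₀ u₁ u ux ut)
    (R : ℝ) (hR : L < R) :
    (fun t : ℝ => LocalEnergyDecay.localEnergy c ux ut R t)
      =O[atTop] (fun t : ℝ => t ^ (-(1 - LocalEnergyDecay.eta c dc L))) := by
  open LocalEnergyDecay in
  obtain ⟨κ, hκ, hκc⟩ := hA1.exists_isCoefficient hA2
  have hlaws := hu.conservationLaws hκ.memLp hκc
  have hux0 : (ux 0 : ℝ → ℝ) =ᵐ[volume] du₀ := by
    have := hu.regularity.weakDeriv 0 le_rfl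
    rw [hu.initial] at this
    exact this.ae_eq hu₀
  have hD : Integrable fun x => |x| * energyDensity κ (ut 0) (ux 0) x := by
    have hdens : AEStronglyMeasurable (fun x => energyDensity κ (ut 0) (ux 0) x) volume := by
      simpa using
        (integrable_weightedEnergy hκ.memLp memLp_top_one (ut 0) (ux 0)).aestronglyMeasurable
    refine hweight.mono' (continuous_abs.aestronglyMeasurable.mul hdens) ?_
    filter_upwards [hκc, hux0] with x h1 h2
    have h3 := hκ.energyDensity_nonneg (ut 0) (ux 0) x
    rw [Real.norm_of_nonneg (mul_nonneg (abs_nonneg x) h3)]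
    have h4 : 1 / c x ^ 2 * |u₁ x| ^ 2 + |du₀ x| ^ 2 = 2 * energyDensity κ (ut 0) (ux 0) x := by
      rw [energyDensity, h1, h2, hu.initial_deriv, sq_abs, sq_abs]
      ring
    rw [h4]
    nlinarith [abs_nonneg x]
  obtain ⟨C, hC, hle⟩ := hlaws.exists_localEnergy_le hκ hR hD
  have hη0 : 0 ≤ eta c dc L := by
    have := hA2.pos.le
    unfold eta linftyNorm
    positivity
  simp only [localEnergy_eq_weightedEnergy hκc]
  exact isBigO_rpow_of_sub_mul_le
    (continuousOn_weightedEnergy hκ.memLp (memLp_ballWeight R) hlaws.continuousOn_fst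
      hlaws.continuousOn_snd)
    (fun t _ => hκ.weightedEnergy_nonneg (ballWeight_nonneg R) _ _)
    (mul_nonneg hκ.K_nonneg (hκ.L_pos.trans hR).le) hC hη0 hη hle
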